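/- **Theorem (Cooling: weak LLN).** Let $\alpha$ be a probability distribution on $(0,1)$, let $\langle\cdot\rangle$ denote expectation with respect to $\alpha$, and for $\omega(0)$ distributed as $\alpha$ put $\rho(0)=\frac{1-\omega(0)}{\omega(0)}$. Assume that $\langle\log\rho(0)\rangle$ is well defined in $[-\infty,\infty)$ and that $\langle\log\rho(0)\rangle\le 0$. Let $\mu=\alpha^{\mathbb Z}$, and let $v_\mu$ be the speed of the static random walk in random environment with law $\mu$, that is, $$v_\mu=\frac{1-\langle\rho(0)\rangle}{1+\langle\rho(0)\rangle}\ \text{ if }\langle\rho(0)\rangle<1,\qquad v_\mu=0\ \text{ if }\langle\rho(0)\rangle\in[1,\infty].$$ Let $\tau\colon\mathbb N_0\to\mathbb N_0$ be strictly increasing with $\tau(0)=0$, and let $T_k=\tau(k)-\tau(k-1)$ for $k\ge 1$. Let $\Omega=(\omega_n)_{n\in\mathbb N_0}$ be the random space-time environment with $\omega_n=\eta_k$ for $\tau(k)\le n<\tau(k+1)$, where $\eta_0,\eta_1,\dots$ are i.i.d. with law $\mu$; write $\mathbb Q$ for the law of $\Omega$. Given $\Omega$, let $P^\Omega$ be the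 law of the Markov chain $X=(X_n)_{n\in\mathbb N_0}$ on $\mathbb Z$ with $X_0=0$ and $$P^\Omega(X_{n+1}=x+1\mid X_n=x)=\omega_n(x),\qquad P^\Omega(X_{n+1}=x-1\mid X_n=x)=1-\omega_n(x),$$ and let $\mathbb P_{\mathbb Q}(\cdot)=\int P^\Omega(\cdot)\,\mathbb Q(\mathrm d\Omega)$ be the annealed law. If $\lim_{k\to\infty}T_k=\infty$, then, under $\mathbb P_{\mathbb Q}$, $X_n/n$ converges to the constant $v_\mu$ as $n\to\infty$, in distribution and (equivalently) in probability. -/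

import Mathlib

open MeasureTheory ProbabilityTheory Filter

namespace RWCRE

/-- Space environments `ω : ℤ → (0,1)`. -/
abbrev SpaceEnv : Type := ℤ → Set.Ioo (0 : ℝ) 1

/-- Space-time environments `Ω = (ω_n)_{n ≥ 0}`. -/
abbrev SpaceTimeEnv : Type := ℕ → SpaceEnv

/-- Law of one nearest-neighbour step from `x`: to `x + 1` with probability `p`,
to `x - 1` with probability `1 - p`. -/
noncomputable def stepLaw (p : Set.Ioo (0 : ℝ) 1) (x : ℤ) : Measure ℤ :=
  ENNReal.ofReal p • Measure.dirac (x + 1) + ENNReal.ofReal (1 - p) • Measure.dirac (x - 1)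

/-- Transition kernel at time `n` in the space-time environment `Ω`: given the trajectory
`(x_0, …, x_n)`, step from `x_n` with probability `ω_n(x_n)` to the right. -/
noncomputable def transition (Ω : SpaceTimeEnv) (n : ℕ) :
    Kernel ((i : Finset.Iic n) → (fun _ : ℕ => ℤ) i) ℤ :=
  Kernel.ofFunOfCountable fun x =>
    stepLaw (Ω n (x ⟨n, Finset.mem_Iic.2 le_rfl⟩)) (x ⟨n, Finset.mem_Iic.2 le_rfl⟩)

instance (p : Set.Ioo (0 : ℝ) 1) (x : ℤ) : IsProbabilityMeasure (stepLaw p x) := by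
  constructor
  have h0 : (0 : ℝ) ≤ p := p.2.1.le
  have h1 : (0 : ℝ) ≤ 1 - p := by linarith [p.2.2]
  simp [stepLaw, ← ENNReal.ofReal_add h0 h1]

instance (Ω : SpaceTimeEnv) (n : ℕ) : IsMarkovKernel (transition Ω n) :=
  ⟨fun _ => inferInstanceAs (IsProbabilityMeasure (stepLaw _ _))⟩

/-- The quenched law `P^Ω` on trajectories: the law of the Markov chain started at `0` with
transition kernels `transition Ω n`. -/
noncomputable def quenchedLaw (Ω : SpaceTimeEnv) : Measure (ℕ → ℤ) :=
  Kernel.trajMeasure (X := fun _ => ℤ) (Measure.dirac 0) (transition Ω)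

instance (Ω : SpaceTimeEnv) : IsProbabilityMeasure (quenchedLaw Ω) := by
  unfold quenchedLaw; infer_instance

theorem cylinder_eq_preimage (y : ℕ → ℤ) (n : ℕ) :
    {x : ℕ → ℤ | ∀ i ≤ n, x i = y i} =
      (Preorder.frestrictLe n : (ℕ → ℤ) → _) ⁻¹' {Preorder.frestrictLe n y} := by
  ext x
  simp [funext_iff, Preorder.frestrictLe]

theorem quenchedLaw_cylinder_zero (Ω : SpaceTimeEnv) (y : ℕ → ℤ) :
    quenchedLaw Ω {x | ∀ i ≤ 0, x i = y i} = if y 0 = 0 then 1 else 0 := by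
  have hset : {x : ℕ → ℤ | ∀ i ≤ 0, x i = y i} = (fun x => x 0) ⁻¹' {y 0} := by
    ext x; simp
  have hmap : (quenchedLaw Ω).map (fun x => x 0) = Measure.dirac 0 := by
    have hc : (fun x : ℕ → ℤ => x 0) =
        (fun z : ((i : Finset.Iic 0) → (fun _ : ℕ => ℤ) i) => z ⟨0, Finset.mem_Iic.2 le_rfl⟩) ∘
          Preorder.frestrictLe 0 := rfl
    rw [hc, ← Measure.map_map (by fun_prop) (by fun_prop), quenchedLaw, Kernel.trajMeasure,
      Measure.map_comp _ _ (by fun_prop), Kernel.traj_map_frestrictLe, Kernel.partialTraj_self,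
      Measure.id_comp, Measure.map_map (by fun_prop) (by fun_prop)]
    exact Measure.map_id
  rw [hset, ← Measure.map_apply (measurable_pi_apply 0) (measurableSet_singleton _), hmap]
  simp [Set.indicator, eq_comm]

theorem quenchedLaw_cylinder_succ (Ω : SpaceTimeEnv) (y : ℕ → ℤ) (n : ℕ) :
    quenchedLaw Ω {x | ∀ i ≤ n + 1, x i = y i} =
      quenchedLaw Ω {x | ∀ i ≤ n, x i = y i} * stepLaw (Ω n (y n)) (y n) {y (n + 1)} := by
  have h := Kernel.map_frestrictLe_trajMeasure_compProd_eq_map_trajMeasure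
    (X := fun _ => ℤ) (μ₀ := Measure.dirac 0) (κ := transition Ω) (a := n)
  have h2 := congrArg
    (fun m => m ({Preorder.frestrictLe n y} ×ˢ {y (n + 1)})) h
  have hp : (fun x : ℕ → ℤ => (Preorder.frestrictLe n x, x (n + 1))) ⁻¹'
      ({Preorder.frestrictLe n y} ×ˢ {y (n + 1)}) = {x : ℕ → ℤ | ∀ i ≤ n + 1, x i = y i} := by
    ext x
    simp only [Set.mem_preimage, Set.mem_prod, Set.mem_singleton_iff, Set.mem_ofPred_eq,
      Nat.le_succ_iff_eq_or_le]
    have := Set.ext_iff.1 (cylinder_eq_preimage y n) x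
    simp only [Set.mem_ofPred_eq, Set.mem_preimage, Set.mem_singleton_iff] at this
    rw [← this]
    aesop
  rw [Measure.compProd_apply_prod (by measurability) (by measurability),
    lintegral_singleton, Measure.map_apply (by fun_prop) (by measurability),
    Measure.map_apply (by fun_prop) (by measurability), hp, ← cylinder_eq_preimage] at h2
  rw [quenchedLaw, ← h2, mul_comm]
  rfl

theorem measurable_quenchedLaw : Measurable quenchedLaw := by
  have hcyl : ∀ (y : ℕ → ℤ) (n : ℕ),
      Measurable fun Ω => quenchedLaw Ω {x | ∀ i ≤ n, x i = y i} := by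
    intro y n
    induction n with
    | zero => simp only [quenchedLaw_cylinder_zero]; exact measurable_const
    | succ n ih =>
      simp only [quenchedLaw_cylinder_succ]
      refine ih.mul ?_
      simp only [stepLaw, Measure.add_apply, Measure.smul_apply, smul_eq_mul]
      fun_prop
  refine Measurable.measure_of_isPiSystem_of_isProbabilityMeasure
    generateFrom_measurableCylinders.symm isPiSystem_measurableCylinders ?_
  intro t ht
  obtain ⟨N, S, mS, rfl⟩ : ∃ N S, MeasurableSet S ∧ t = cylinder (Finset.Iic N) S := by
    simpa [measurableCylinders_nat] using ht
  have hS : (cylinder (Finset.Iic N) S : Set (ℕ → ℤ)) =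
      ⋃ z : S, (Preorder.frestrictLe N : (ℕ → ℤ) → _) ⁻¹' {z.1} := by
    ext x
    simp [Preorder.frestrictLe]
  have hm : ∀ z : S, MeasurableSet ((Preorder.frestrictLe N : (ℕ → ℤ) → _) ⁻¹' {z.1}) :=
    fun z => Preorder.measurable_frestrictLe N (measurableSet_singleton _)
  have hd : Pairwise (Function.onFun Disjoint fun z : S =>
      (Preorder.frestrictLe N : (ℕ → ℤ) → _) ⁻¹' {z.1}) := fun a b hab =>
    Disjoint.preimage _ (Set.disjoint_singleton.2 fun h => hab (Subtype.ext h))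
  rw [hS]
  simp_rw [measure_iUnion hd hm]
  refine Measurable.tsum fun z => ?_
  have hz : Preorder.frestrictLe (π := fun _ => ℤ) N
      (fun i => if h : i ∈ Finset.Iic N then z.1 ⟨i, h⟩ else 0) = z.1 := by
    ext i
    have := i.2
    simp only [Preorder.frestrictLe_apply, this, dif_pos]
  rw [← hz, ← cylinder_eq_preimage]
  exact hcyl _ N

/-- The quenched law as a Markov kernel from environments to trajectories. -/
noncomputable def quenchedKernel : Kernel SpaceTimeEnv (ℕ → ℤ) :=
  ⟨quenchedLaw, measurable_quenchedLaw⟩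

instance : IsMarkovKernel quenchedKernel :=
  ⟨fun Ω => inferInstanceAs (IsProbabilityMeasure (quenchedLaw Ω))⟩

/-- `k(n) = max {k : τ(k) ≤ n}`, the index of the last resampling up to time `n`
(for `τ` strictly increasing with `τ(0) = 0`, every `k` with `τ(k) ≤ n` satisfies `k ≤ n`). -/
def lastResampling (τ : ℕ → ℕ) (n : ℕ) : ℕ := Nat.findGreatest (fun k => τ k ≤ n) n

/-- The law `μ = α^ℤ` of an i.i.d. space environment. -/
noncomputable def spaceEnvLaw (α : Measure (Set.Ioo (0 : ℝ) 1)) : Measure SpaceEnv :=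
  Measure.infinitePi fun _ : ℤ => α

instance (α : Measure (Set.Ioo (0 : ℝ) 1)) [IsProbabilityMeasure α] :
    IsProbabilityMeasure (spaceEnvLaw α) := by
  unfold spaceEnvLaw; infer_instance

theorem measurable_cooling (τ : ℕ → ℕ) :
    Measurable fun (η : ℕ → SpaceEnv) (n : ℕ) => η (lastResampling τ n) := by
  fun_prop

/-- The law `ℚ = ℚ_{α,τ}` of the cooling environment: with `η_0, η_1, …` i.i.d. of law `μ`,
the environment in force at time `n` is `ω_n = η_{k(n)}`, i.e. a fresh sample is drawn at each time
`τ(k)` and kept during `[τ(k), τ(k+1))`. -/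
noncomputable def envLaw (α : Measure (Set.Ioo (0 : ℝ) 1)) [IsProbabilityMeasure α] (τ : ℕ → ℕ) :
    Measure SpaceTimeEnv :=
  (Measure.infinitePi fun _ : ℕ => spaceEnvLaw α).map fun η n => η (lastResampling τ n)

instance (α : Measure (Set.Ioo (0 : ℝ) 1)) [IsProbabilityMeasure α] (τ : ℕ → ℕ) :
    IsProbabilityMeasure (envLaw α τ) :=
  Measure.isProbabilityMeasure_map (measurable_cooling τ).aemeasurable

/-- The annealed law `∫ P^Ω(·) ℚ(dΩ)` on trajectories. -/
noncomputable def annealedLaw (α : Measure (Set.Ioo (0 : ℝ) 1)) [IsProbabilityMeasure α]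
    (τ : ℕ → ℕ) : Measure (ℕ → ℤ) :=
  (envLaw α τ).bind quenchedKernel

instance (α : Measure (Set.Ioo (0 : ℝ) 1)) [IsProbabilityMeasure α] (τ : ℕ → ℕ) :
    IsProbabilityMeasure (annealedLaw α τ) := by
  unfold annealedLaw; infer_instance

/-- `ρ = (1 - p) / p`. -/
noncomputable def rho (p : Set.Ioo (0 : ℝ) 1) : ℝ := (1 - p) / p

/-- `⟨log ρ⟩ ≤ 0`, the mean being that of an arbitrary law `α` for which it exists in `[-∞, ∞)`:
the positive part of `log ρ` has a finite mean, which is at most the (possibly infinite) mean of the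
negative part. -/
def MeanLogRhoNonpos (α : Measure (Set.Ioo (0 : ℝ) 1)) : Prop :=
  ∫⁻ p, ENNReal.ofReal (Real.log (rho p)) ∂α < ⊤ ∧
    ∫⁻ p, ENNReal.ofReal (Real.log (rho p)) ∂α ≤ ∫⁻ p, ENNReal.ofReal (-Real.log (rho p)) ∂α

/-- `⟨ρ⟩`, the mean of the positive function `ρ`, possibly infinite. -/
noncomputable def meanRho (α : Measure (Set.Ioo (0 : ℝ) 1)) : ENNReal :=
  ∫⁻ p, ENNReal.ofReal (rho p) ∂α

open Classical in
/-- The speed `v_μ` of the static walk: `(1 - ⟨ρ⟩) / (1 + ⟨ρ⟩)` if `⟨ρ⟩ < 1`, and `0` otherwise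
(for `⟨log ρ⟩ ≤ 0`; by Jensen `⟨ρ⟩ < 1` forces `⟨log ρ⟩ < 0`). -/
noncomputable def staticSpeed (α : Measure (Set.Ioo (0 : ℝ) 1)) : ℝ :=
  if meanRho α < 1 then (1 - (meanRho α).toReal) / (1 + (meanRho α).toReal) else 0

end RWCRE

namespace RWCRE

/-! ### Quenched expectations -/

/-! The proof works in mean: E|X_n - v n| = o(n), and Markov's inequality then gives convergence in
probability. No regeneration or ergodic theory enters; only second moments and one family of
potentials do.

Static walk (`exists_static_bound`): E|X_t - v t| ≤ ε t + A. Mean times D(x) to step from x to x + 1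
solve D(x) = 1 + ρ(x) + ρ(x) D(x - 1), and a function with increments D, evaluated along the walk,
minus time is a martingale. Capping ρ at K and stopping the recursion at depth J makes D bounded and
finite-range dependent, at the price of a supermartingale whose positive part has second moment O(t)
(`walkMean_sq_max_le`). Finite-range dependence keeps the potential close to c x on [-t, t], where c
is the mean of D (`exists_gridBound_le`). So X_t ≤ t/c + o(t) in mean, and 1/c comes as close to v
as desired (`exists_crossMean_inv_le`). For the opposite bound there are two cases. If ⟨ρ⟩ < 1, the
uncapped recursion taken deep enough is an exact martingale on the reachable sites and yields E X_t
≥ v t - o(t); conclude by |z| = 2 z⁺ - z. If ⟨ρ⟩ ≥ 1, then v = 0, and the upper bound also applies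
to the reflected walk, whose ratio is 1/ρ, because ⟨log ρ⟩ ≤ 0 forces ⟨1/ρ⟩ ≥ 1
(`one_le_meanRho_reflect`).

Cooling walk: at time τ(k) the fresh environment is independent of the position reached and its law
is translation invariant, so a block of length t adds at most ε t + A to the mean deviation
(`meanDeviation_add_le`). The constant A is paid once per resampling, and T_k → ∞ makes the number
of resamplings up to time n negligible against n (`exists_index_le`). -/

/-- One-step expectation of `f` for the walk standing at `x` in the space environment `ω`. -/
noncomputable def stepMean (ω : SpaceEnv) (f : ℤ → ℝ) (x : ℤ) : ℝ :=
  ω x * f (x + 1) + (1 - ω x) * f (x - 1)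

/-- Expectation of `f (X_n)` for the walk started at `x` in the space-time environment `Ω`. -/
noncomputable def walkMean (Ω : SpaceTimeEnv) : ℕ → (ℤ → ℝ) → ℤ → ℝ
  | 0, f => f
  | n + 1, f => walkMean Ω n (stepMean (Ω n) f)

@[simp] theorem walkMean_zero (Ω : SpaceTimeEnv) (f : ℤ → ℝ) : walkMean Ω 0 f = f := rfl

theorem walkMean_succ (Ω : SpaceTimeEnv) (n : ℕ) (f : ℤ → ℝ) :
    walkMean Ω (n + 1) f = walkMean Ω n (stepMean (Ω n) f) := rfl

theorem env_pos (ω : SpaceEnv) (x : ℤ) : 0 < (ω x : ℝ) := (ω x).2.1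

theorem env_lt_one (ω : SpaceEnv) (x : ℤ) : (ω x : ℝ) < 1 := (ω x).2.2

theorem stepMean_mono (ω : SpaceEnv) {f g : ℤ → ℝ} {x : ℤ}
    (hr : f (x + 1) ≤ g (x + 1)) (hl : f (x - 1) ≤ g (x - 1)) :
    stepMean ω f x ≤ stepMean ω g x :=
  add_le_add (mul_le_mul_of_nonneg_left hr (env_pos ω x).le)
    (mul_le_mul_of_nonneg_left hl (sub_nonneg.2 (env_lt_one ω x).le))

/-- Nearest-neighbour steps reach only sites within distance n. This locality lets later estimates
be checked on [-t, t] only. -/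
theorem walkMean_mono (Ω : SpaceTimeEnv) (n : ℕ) {f g : ℤ → ℝ} {x : ℤ}
    (h : ∀ y, |y - x| ≤ n → f y ≤ g y) : walkMean Ω n f x ≤ walkMean Ω n g x := by
  induction n generalizing f g with
  | zero => exact h x (by simp)
  | succ n ih =>
    refine ih fun y hy => stepMean_mono _ (h _ ?_) (h _ ?_) <;>
    · rw [abs_le] at hy ⊢
      push_cast
      omega

theorem walkMean_congr (Ω : SpaceTimeEnv) (n : ℕ) {f g : ℤ → ℝ} {x : ℤ}
    (h : ∀ y, |y - x| ≤ n → f y = g y) : walkMean Ω n f x = walkMean Ω n g x :=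
  (walkMean_mono Ω n fun y hy => (h y hy).le).antisymm
    (walkMean_mono Ω n fun y hy => (h y hy).ge)

theorem walkMean_const (Ω : SpaceTimeEnv) (n : ℕ) (c : ℝ) :
    walkMean Ω n (fun _ => c) = fun _ => c := by
  induction n with
  | zero => rfl
  | succ n ih =>
    rw [walkMean_succ, ← ih]
    congr 1
    ext x
    simp only [stepMean, ih]
    ring

theorem walkMean_add (Ω : SpaceTimeEnv) (n : ℕ) (f g : ℤ → ℝ) (x : ℤ) :
    walkMean Ω n (fun y => f y + g y) x = walkMean Ω n f x + walkMean Ω n g x := by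
  induction n generalizing f g with
  | zero => rfl
  | succ n ih =>
    simp only [walkMean_succ, ← ih]
    congr 1
    ext y
    simp only [stepMean]
    ring

theorem walkMean_mul (Ω : SpaceTimeEnv) (n : ℕ) (c : ℝ) (f : ℤ → ℝ) (x : ℤ) :
    walkMean Ω n (fun y => c * f y) x = c * walkMean Ω n f x := by
  induction n generalizing f with
  | zero => rfl
  | succ n ih =>
    simp only [walkMean_succ, ← ih]
    congr 1
    ext y
    simp only [stepMean]
    ring

theorem walkMean_nonneg (Ω : SpaceTimeEnv) (n : ℕ) {f : ℤ → ℝ} (hf : ∀ y, 0 ≤ f y) (x : ℤ) :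
    0 ≤ walkMean Ω n f x := by
  have := walkMean_mono Ω n (f := fun _ => 0) (g := f) (x := x) fun y _ => hf y
  rwa [walkMean_const] at this

theorem walkMean_sum (Ω : SpaceTimeEnv) (n : ℕ) {ι : Type*} (s : Finset ι) (f : ι → ℤ → ℝ)
    (x : ℤ) : walkMean Ω n (fun y => ∑ i ∈ s, f i y) x = ∑ i ∈ s, walkMean Ω n (f i) x := by
  classical
  induction s using Finset.induction_on with
  | empty => simp [walkMean_const]
  | insert a s ha ih => simp [Finset.sum_insert ha, walkMean_add, ih]

/-- The quenched expectation as a finite sum against the quenched distribution. -/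
theorem walkMean_eq_sum (Ω : SpaceTimeEnv) (n : ℕ) (f : ℤ → ℝ) :
    walkMean Ω n f 0 = ∑ z ∈ Finset.Icc (-n : ℤ) n,
      walkMean Ω n (fun y => if y = z then 1 else 0) 0 * f z := by
  have h : walkMean Ω n f 0 = walkMean Ω n
      (fun y => ∑ z ∈ Finset.Icc (-n : ℤ) n, f z * if y = z then 1 else 0) 0 := by
    refine walkMean_congr Ω n fun y hy => ?_
    rw [sub_zero, abs_le] at hy
    simp [hy]
  rw [h, walkMean_sum]
  exact Finset.sum_congr rfl fun z _ => by rw [walkMean_mul, mul_comm]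

theorem walkMean_env_congr {Ω Ω' : SpaceTimeEnv} {n : ℕ} (h : ∀ i < n, Ω i = Ω' i)
    (f : ℤ → ℝ) : walkMean Ω n f = walkMean Ω' n f := by
  induction n generalizing f with
  | zero => rfl
  | succ n ih =>
    rw [walkMean_succ, walkMean_succ, h n (by omega), ih fun i hi => h i (by omega)]

/-- The Markov property at a fixed time. -/
theorem walkMean_time_add (Ω : SpaceTimeEnv) (s t : ℕ) (f : ℤ → ℝ) :
    walkMean Ω (s + t) f = walkMean Ω s (walkMean (fun i => Ω (s + i)) t f) := by
  induction t generalizing f with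
  | zero => rfl
  | succ t ih => rw [← add_assoc, walkMean_succ, ih, walkMean_succ]

theorem walkMean_translate (Ω : SpaceTimeEnv) (n : ℕ) (f : ℤ → ℝ) (x y : ℤ) :
    walkMean Ω n f (x + y) = walkMean (fun i z => Ω i (z + y)) n (fun z => f (z + y)) x := by
  induction n generalizing f with
  | zero => rfl
  | succ n ih =>
    rw [walkMean_succ, ih, walkMean_succ]
    congr 1
    ext z
    simp only [stepMean]
    rw [show z + y + 1 = z + 1 + y by ring, show z + y - 1 = z - 1 + y by ring]

/-- The reflection of a site variable: `p ↦ 1 - p`. -/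
def reflectSite (p : Set.Ioo (0 : ℝ) 1) : Set.Ioo (0 : ℝ) 1 :=
  ⟨1 - p, by linarith [p.2.2], by linarith [p.2.1]⟩

theorem measurable_reflectSite : Measurable reflectSite :=
  (measurable_const.sub measurable_subtype_coe).subtype_mk

theorem walkMean_reflect (Ω : SpaceTimeEnv) (n : ℕ) (f : ℤ → ℝ) (x : ℤ) :
    walkMean Ω n (fun y => f (-y)) x =
      walkMean (fun i z => reflectSite (Ω i (-z))) n f (-x) := by
  induction n generalizing f x with
  | zero => rfl
  | succ n ih =>
    rw [walkMean_succ, walkMean_succ, ← ih]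
    congr 1
    ext z
    simp only [stepMean, reflectSite, neg_neg]
    rw [show -(z + 1) = -z - 1 by ring, show -(z - 1) = -z + 1 by ring]
    ring

theorem measurable_walkMean {E : Type*} [MeasurableSpace E] {Ω : E → SpaceTimeEnv}
    (hΩ : Measurable Ω) (n : ℕ) {f : E → ℤ → ℝ} (hf : ∀ x, Measurable fun e => f e x) (x : ℤ) :
    Measurable fun e => walkMean (Ω e) n (f e) x := by
  induction n generalizing f with
  | zero => exact hf x
  | succ n ih =>
    refine ih fun y => ?_
    have h : Measurable fun e => (Ω e n y : ℝ) := by fun_prop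
    exact (h.mul (hf _)).add ((measurable_const.sub h).mul (hf _))

theorem measurable_walkMean_const {E : Type*} [MeasurableSpace E] {Ω : E → SpaceTimeEnv}
    (hΩ : Measurable Ω) (n : ℕ) (f : ℤ → ℝ) (x : ℤ) :
    Measurable fun e => walkMean (Ω e) n f x :=
  measurable_walkMean (f := fun _ => f) hΩ n (fun _ => measurable_const) x

/-! ### Quenched expectations as integrals over trajectories -/

theorem lintegral_stepLaw (ω : SpaceEnv) (x : ℤ) {f : ℤ → ℝ} (hf : ∀ y, 0 ≤ f y) :
    ∫⁻ y, ENNReal.ofReal (f y) ∂stepLaw (ω x) x = ENNReal.ofReal (stepMean ω f x) := by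
  have h0 := (env_pos ω x).le
  have h1 : 0 ≤ 1 - (ω x : ℝ) := sub_nonneg.2 (env_lt_one ω x).le
  rw [stepLaw, lintegral_add_measure, lintegral_smul_measure, lintegral_smul_measure,
    lintegral_dirac, lintegral_dirac, stepMean, ENNReal.ofReal_add (mul_nonneg h0 (hf _))
    (mul_nonneg h1 (hf _)), ENNReal.ofReal_mul h0, ENNReal.ofReal_mul h1]
  rfl

theorem lintegral_quenchedLaw_zero (Ω : SpaceTimeEnv) (f : ℤ → ENNReal) :
    ∫⁻ x, f (x 0) ∂quenchedLaw Ω = f 0 := by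
  have h0 : quenchedLaw Ω {x | ∀ i ≤ 0, x i = 0} = 1 := by
    simpa using quenchedLaw_cylinder_zero Ω (fun _ => 0)
  have hae : ∀ᵐ x ∂quenchedLaw Ω, f (x 0) = f 0 := by
    have hm : MeasurableSet {x : ℕ → ℤ | ∀ i ≤ 0, x i = 0} := by
      simp only [nonpos_iff_eq_zero, forall_eq]
      exact measurable_pi_apply 0 (measurableSet_singleton _)
    filter_upwards [(prob_compl_eq_zero_iff hm).2 h0] with x hx
    rw [hx 0 le_rfl]
  rw [lintegral_congr_ae hae]
  simp

theorem lintegral_quenchedLaw_succ (Ω : SpaceTimeEnv) (n : ℕ) (f : ℤ → ENNReal) :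
    ∫⁻ x, f (x (n + 1)) ∂quenchedLaw Ω =
      ∫⁻ x, ∫⁻ y, f y ∂stepLaw (Ω n (x n)) (x n) ∂quenchedLaw Ω := by
  have h := congrArg (fun m => ∫⁻ p, f p.2 ∂m)
    (Kernel.map_frestrictLe_trajMeasure_compProd_eq_map_trajMeasure
      (X := fun _ => ℤ) (μ₀ := Measure.dirac 0) (κ := transition Ω) (a := n))
  have hf : Measurable f := measurable_of_countable f
  rw [Measure.lintegral_compProd (by fun_prop), lintegral_map (by fun_prop) (by fun_prop),
    lintegral_map (by fun_prop) (by fun_prop)] at h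
  exact h.symm

theorem lintegral_quenchedLaw (Ω : SpaceTimeEnv) (n : ℕ) {f : ℤ → ℝ} (hf : ∀ y, 0 ≤ f y) :
    ∫⁻ x, ENNReal.ofReal (f (x n)) ∂quenchedLaw Ω = ENNReal.ofReal (walkMean Ω n f 0) := by
  induction n generalizing f with
  | zero => exact lintegral_quenchedLaw_zero Ω fun y => ENNReal.ofReal (f y)
  | succ n ih =>
    rw [lintegral_quenchedLaw_succ Ω n fun y => ENNReal.ofReal (f y), walkMean_succ, ← ih]
    · simp only [lintegral_stepLaw _ _ hf]
    · intro y
      exact add_nonneg (mul_nonneg (env_pos _ _).le (hf _))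
        (mul_nonneg (sub_nonneg.2 (env_lt_one _ _).le) (hf _))

theorem lintegral_annealedLaw (α : Measure (Set.Ioo (0 : ℝ) 1)) [IsProbabilityMeasure α]
    (τ : ℕ → ℕ) (n : ℕ) {f : ℤ → ℝ} (hf : ∀ y, 0 ≤ f y) :
    ∫⁻ x, ENNReal.ofReal (f (x n)) ∂annealedLaw α τ =
      ∫⁻ η, ENNReal.ofReal (walkMean (fun i => η (lastResampling τ i)) n f 0)
        ∂Measure.infinitePi fun _ : ℕ => spaceEnvLaw α := by
  have hm : Measurable fun x : ℕ → ℤ => ENNReal.ofReal (f (x n)) :=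
    (measurable_of_countable fun y => ENNReal.ofReal (f y)).comp (measurable_pi_apply n)
  rw [annealedLaw, Measure.lintegral_bind quenchedKernel.measurable.aemeasurable hm.aemeasurable,
    envLaw, lintegral_map hm.lintegral_kernel (measurable_cooling τ)]
  exact lintegral_congr fun η => lintegral_quenchedLaw _ n hf

/-! ### Potentials adapted to an environment -/

/-- Mean time needed to step from `x` to `x + 1`, truncated at depth `j`, when the ratio
`(1 - p) / p` at the site `y` is `r y`. -/
def crossTime (r : ℤ → ℝ) : ℕ → ℤ → ℝ
  | 0, _ => 0
  | j + 1, x => 1 + r x + r x * crossTime r j (x - 1)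

theorem crossTime_zero (r : ℤ → ℝ) (x : ℤ) : crossTime r 0 x = 0 := rfl

theorem crossTime_succ (r : ℤ → ℝ) (j : ℕ) (x : ℤ) :
    crossTime r (j + 1) x = 1 + r x + r x * crossTime r j (x - 1) := rfl

theorem crossTime_nonneg {r : ℤ → ℝ} (hr : ∀ x, 0 ≤ r x) (j : ℕ) (x : ℤ) :
    0 ≤ crossTime r j x := by
  induction j generalizing x with
  | zero => exact le_rfl
  | succ j ih =>
    have := hr x
    have := ih (x - 1)
    rw [crossTime_succ]
    positivity

theorem crossTime_mono {r r' : ℤ → ℝ} (hr : ∀ x, 0 ≤ r x) (h : ∀ x, r x ≤ r' x)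
    {j j' : ℕ} (hj : j ≤ j') (x : ℤ) : crossTime r j x ≤ crossTime r' j' x := by
  induction j generalizing x j' with
  | zero => exact crossTime_nonneg (fun y => (hr y).trans (h y)) j' x
  | succ j ih =>
    obtain ⟨j', rfl⟩ : ∃ i, j' = i + 1 := ⟨j' - 1, by omega⟩
    have h1 := ih (show j ≤ j' by omega) (x - 1)
    have h2 := mul_le_mul (h x) h1 (crossTime_nonneg hr j _) ((hr x).trans (h x))
    rw [crossTime_succ, crossTime_succ]
    linarith [h x]

/-- Only the ratios in the window (x - j, x] are read, which is the source of finite-range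
dependence. -/
theorem crossTime_congr {r r' : ℤ → ℝ} {j : ℕ} {x : ℤ}
    (h : ∀ y ∈ Finset.Ioc (x - j) x, r y = r' y) : crossTime r j x = crossTime r' j x := by
  induction j generalizing x with
  | zero => rfl
  | succ j ih =>
    rw [crossTime_succ, crossTime_succ, h x (by simp),
      ih fun y hy => h y (by simp only [Finset.mem_Ioc] at hy ⊢; push_cast; omega)]

/-- The value of `crossTime` for the constant ratio `c`. -/
def crossMean (c : ℝ) : ℕ → ℝ
  | 0 => 0
  | j + 1 => 1 + c + c * crossMean c j

theorem crossMean_succ (c : ℝ) (j : ℕ) : crossMean c (j + 1) = 1 + c + c * crossMean c j := rfl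

theorem crossTime_const (c : ℝ) (j : ℕ) (x : ℤ) : crossTime (fun _ => c) j x = crossMean c j := by
  induction j generalizing x with
  | zero => rfl
  | succ j ih => rw [crossTime_succ, ih, crossMean_succ]

theorem crossMean_nonneg {c : ℝ} (hc : 0 ≤ c) (j : ℕ) : 0 ≤ crossMean c j := by
  rw [← crossTime_const c j 0]
  exact crossTime_nonneg (fun _ => hc) j 0

theorem crossMean_mono {c c' : ℝ} (hc : 0 ≤ c) (h : c ≤ c') {j j' : ℕ} (hj : j ≤ j') :
    crossMean c j ≤ crossMean c' j' := by
  rw [← crossTime_const c j 0, ← crossTime_const c' j' 0]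
  exact crossTime_mono (fun _ => hc) (fun _ => h) hj 0

theorem crossTime_le_crossMean {r : ℤ → ℝ} {K : ℝ} (hr : ∀ x, 0 ≤ r x) (h : ∀ x, r x ≤ K)
    (j : ℕ) (x : ℤ) : crossTime r j x ≤ crossMean K j := by
  rw [← crossTime_const K j x]
  exact crossTime_mono hr h le_rfl x

theorem crossMean_eq {c : ℝ} (hc : c ≠ 1) (j : ℕ) :
    crossMean c j = (1 + c) / (1 - c) * (1 - c ^ j) := by
  have h : 1 - c ≠ 0 := sub_ne_zero.2 hc.symm
  induction j with
  | zero => simp [crossMean]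
  | succ j ih =>
    rw [crossMean_succ, ih]
    field_simp
    ring

theorem crossMean_one (j : ℕ) : crossMean 1 j = 2 * j := by
  induction j with
  | zero => simp [crossMean]
  | succ j ih =>
    rw [crossMean_succ, ih]
    push_cast
    ring

theorem continuous_crossMean (j : ℕ) : Continuous fun c => crossMean c j := by
  induction j with
  | zero => exact continuous_const
  | succ j ih => exact (continuous_const.add continuous_id).add (continuous_id.mul ih)

theorem rho_pos (p : Set.Ioo (0 : ℝ) 1) : 0 < rho p :=
  div_pos (sub_pos.2 p.2.2) p.2.1

/-- The function vanishing at `0` with increments `D`. -/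
noncomputable def potential (D : ℤ → ℝ) (x : ℤ) : ℝ :=
  ∑ y ∈ Finset.Ico 0 x, D y - ∑ y ∈ Finset.Ico x 0, D y

theorem potential_zero (D : ℤ → ℝ) : potential D 0 = 0 := by simp [potential]

theorem potential_of_nonneg (D : ℤ → ℝ) {x : ℤ} (hx : 0 ≤ x) :
    potential D x = ∑ y ∈ Finset.Ico 0 x, D y := by
  simp [potential, Finset.Ico_eq_empty_of_le hx]

theorem potential_of_nonpos (D : ℤ → ℝ) {x : ℤ} (hx : x ≤ 0) :
    potential D x = -∑ y ∈ Finset.Ico x 0, D y := by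
  simp [potential, Finset.Ico_eq_empty_of_le hx]

theorem potential_add_one (D : ℤ → ℝ) (x : ℤ) : potential D (x + 1) = potential D x + D x := by
  rcases le_or_gt 0 x with hx | hx
  · rw [potential_of_nonneg D hx, potential_of_nonneg D (by omega),
      show Finset.Ico 0 (x + 1) = insert x (Finset.Ico 0 x) by ext; simp; omega,
      Finset.sum_insert (by simp), add_comm]
  · rw [potential_of_nonpos D hx.le, potential_of_nonpos D (by omega),
      show Finset.Ico x 0 = insert x (Finset.Ico (x + 1) 0) by ext; simp; omega,
      Finset.sum_insert (by simp)]
    ring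

theorem potential_sub_one (D : ℤ → ℝ) (x : ℤ) :
    potential D (x - 1) = potential D x - D (x - 1) := by
  have := potential_add_one D (x - 1)
  rw [sub_add_cancel] at this
  linarith

theorem abs_potential_add_sub_le {D : ℤ → ℝ} {C : ℝ} (hD : ∀ x, |D x| ≤ C) (x : ℤ) (k : ℕ) :
    |potential D (x + k) - potential D x| ≤ C * k := by
  induction k with
  | zero => simp
  | succ k ih =>
    rw [Nat.cast_succ, ← add_assoc, potential_add_one]
    have := abs_add_le (potential D (x + k) - potential D x) (D (x + k))
    rw [show potential D (x + k) + D (x + k) - potential D x =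
      potential D (x + k) - potential D x + D (x + k) by ring]
    push_cast
    linarith [hD (x + k)]

/-- Since 1 - p = p ρ, the drift p D(x) - (1 - p) D(x - 1) equals one exactly when D solves the
crossing-time equation at x, and is at most one for a subsolution. -/
theorem stepMean_potential (ω : SpaceEnv) (D : ℤ → ℝ) (x : ℤ) :
    stepMean ω (potential D) x = potential D x + 1 +
      ω x * (D x - (1 + rho (ω x) + rho (ω x) * D (x - 1))) := by
  have h := (env_pos ω x).ne'
  rw [stepMean, potential_add_one, potential_sub_one, rho]
  field_simp
  ring

/-- A second-order expansion of y ↦ (y⁺)²: the linear term is killed by the supermartingale drift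
and d² is bounded by the step size. -/
theorem sq_max_zero_add_le (y d : ℝ) :
    max (y + d) 0 ^ 2 ≤ max y 0 ^ 2 + 2 * max y 0 * d + d ^ 2 := by
  have h : max y 0 ^ 2 + 2 * max y 0 * d + d ^ 2 = (max y 0 + d) ^ 2 := by ring
  rw [h]
  rcases le_total (y + d) 0 with h1 | h1
  · rw [max_eq_right h1, zero_pow two_ne_zero]
    positivity
  · rw [max_eq_left h1]
    exact pow_le_pow_left₀ h1 (by linarith [le_max_left y 0]) 2

/-- If the potential with bounded increments `D` grows by at most one in the mean per step, then
the second moment of the positive part of `potential D (X_t) - t` grows at most linearly. -/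
theorem walkMean_sq_max_le (ω : SpaceEnv) {D : ℤ → ℝ} {C : ℝ} (hC : ∀ x, |D x| ≤ C)
    (hD : ∀ x, D x ≤ 1 + rho (ω x) + rho (ω x) * D (x - 1)) (t : ℕ) :
    walkMean (fun _ => ω) t (fun x => max (potential D x - t) 0 ^ 2) 0 ≤ (C + 1) ^ 2 * t := by
  induction t with
  | zero => simp [potential_zero]
  | succ t ih =>
    have key : ∀ x, stepMean ω (fun x => max (potential D x - (t + 1 : ℕ)) 0 ^ 2) x ≤
        max (potential D x - t) 0 ^ 2 + (C + 1) ^ 2 := by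
      intro x
      have hω := env_pos ω x
      have hω' := sub_pos.2 (env_lt_one ω x)
      have hstep := stepMean_potential ω D x
      rw [stepMean, potential_add_one, potential_sub_one] at hstep
      have hneg : (ω x : ℝ) * (D x - (1 + rho (ω x) + rho (ω x) * D (x - 1))) ≤ 0 :=
        mul_nonpos_of_nonneg_of_nonpos hω.le (sub_nonpos.2 (hD x))
      have hdrift : (ω x : ℝ) * (D x - 1) + (1 - ω x) * (-D (x - 1) - 1) ≤ 0 := by linarith
      have hr := sq_max_zero_add_le (potential D x - t) (D x - 1)
      have hl := sq_max_zero_add_le (potential D x - t) (-D (x - 1) - 1)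
      have hsq : ∀ z, |z| ≤ C + 1 → z ^ 2 ≤ (C + 1) ^ 2 := fun z hz => by
        rw [← sq_abs]
        exact pow_le_pow_left₀ (abs_nonneg _) hz 2
      have h1 : (D x - 1) ^ 2 ≤ (C + 1) ^ 2 := hsq _ <| by
        have := abs_le.1 (hC x)
        exact abs_le.2 ⟨by linarith, by linarith⟩
      have h2 : (-D (x - 1) - 1) ^ 2 ≤ (C + 1) ^ 2 := hsq _ <| by
        have := abs_le.1 (hC (x - 1))
        exact abs_le.2 ⟨by linarith, by linarith⟩
      have hp : 0 ≤ max (potential D x - t) 0 := le_max_right _ _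
      simp only [stepMean, potential_add_one, potential_sub_one]
      push_cast
      rw [show potential D x + D x - ((t : ℝ) + 1) = potential D x - t + (D x - 1) by ring,
        show potential D x - D (x - 1) - ((t : ℝ) + 1) =
          potential D x - t + (-D (x - 1) - 1) by ring]
      have e1 := mul_le_mul_of_nonneg_left (hr.trans (add_le_add_right h1 _)) hω.le
      have e2 := mul_le_mul_of_nonneg_left (hl.trans (add_le_add_right h2 _)) hω'.le
      have e3 := mul_nonpos_of_nonneg_of_nonpos hp hdrift
      refine (add_le_add e1 e2).trans ?_
      nlinarith [e3]
    rw [walkMean_succ]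
    refine (walkMean_mono _ t fun y _ => key y).trans ?_
    rw [walkMean_add, walkMean_const]
    push_cast
    linarith

/-- AM-GM with a free parameter: a large `a` turns a second moment of order t into a first moment of
at most ε t plus a constant, without square roots. -/
theorem abs_le_add_inv_mul_sq {a : ℝ} (ha : 0 < a) (z : ℝ) : |z| ≤ a + a⁻¹ * z ^ 2 := by
  have e : a⁻¹ * (|z| - a) ^ 2 = a⁻¹ * z ^ 2 - 2 * |z| + a := by
    rw [← sq_abs z]
    field_simp
    ring
  have : 0 ≤ a⁻¹ * (|z| - a) ^ 2 := by positivity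
  linarith [abs_nonneg z]

theorem walkMean_max_potential_le (ω : SpaceEnv) {D : ℤ → ℝ} {C : ℝ} (hC : ∀ x, |D x| ≤ C)
    (hD : ∀ x, D x ≤ 1 + rho (ω x) + rho (ω x) * D (x - 1)) {a : ℝ} (ha : 0 < a) (t : ℕ) :
    walkMean (fun _ => ω) t (fun x => max (potential D x - t) 0) 0 ≤
      a + a⁻¹ * ((C + 1) ^ 2 * t) := by
  refine (walkMean_mono _ t fun y _ => (le_abs_self _).trans
    (abs_le_add_inv_mul_sq ha _)).trans ?_
  rw [walkMean_add, walkMean_const, walkMean_mul]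
  gcongr
  exact walkMean_sq_max_le ω hC hD t

theorem walkMean_potential_eq (ω : SpaceEnv) {D : ℤ → ℝ} {t : ℕ}
    (hD : ∀ x, -(t : ℤ) ≤ x → D x = 1 + rho (ω x) + rho (ω x) * D (x - 1)) :
    walkMean (fun _ => ω) t (potential D) 0 = t := by
  suffices h : ∀ s ≤ t, walkMean (fun _ => ω) s (potential D) 0 = s from h t le_rfl
  intro s
  induction s with
  | zero => simp [potential_zero]
  | succ s ih =>
    intro hs
    rw [walkMean_succ, walkMean_congr _ s (g := fun x => potential D x + 1), walkMean_add,
      walkMean_const, ih (by omega)]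
    · push_cast; rfl
    · intro y hy
      rw [sub_zero, abs_le] at hy
      rw [stepMean_potential, hD y (by omega)]
      simp

/-- Upper bound for the deviation of a potential from the linear function of slope `c` on
`[-t, t]`, obtained from its values at `2 M + 1` equally spaced points. -/
noncomputable def gridBound (D : ℤ → ℝ) (c C : ℝ) (M t : ℕ) : ℝ :=
  ∑ i ∈ Finset.Icc (-M : ℤ) M,
    |potential D (i * (t / M + 1 : ℕ)) - c * (i * (t / M + 1 : ℕ) : ℤ)| + 2 * C * (t / M + 1 : ℕ)

/-- Compare x with the grid point to its left: both functions have Lipschitz constant C, and the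
deviation at that point is one term of the sum. -/
theorem abs_potential_sub_le_gridBound {D : ℤ → ℝ} {c C : ℝ} (hC : ∀ x, |D x| ≤ C)
    (hc : |c| ≤ C) {M : ℕ} (hM : 0 < M) {t : ℕ} {x : ℤ} (hx : |x| ≤ t) :
    |potential D x - c * x| ≤ gridBound D c C M t := by
  unfold gridBound
  set b : ℕ := t / M + 1 with hb
  have hb0 : (0 : ℤ) < b := Int.natCast_pos.2 (Nat.succ_pos _)
  -- The `+ 1` in the mesh makes `b` positive and lets `M` cells cover [0, t] despite rounding down.
  have htb : (t : ℤ) < M * b := by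
    exact_mod_cast Nat.lt_mul_div_succ t hM
  rw [abs_le] at hx
  set i : ℤ := x / b with hi
  have hmod := Int.emod_add_mul_ediv x b
  obtain ⟨k, hk⟩ := Int.eq_ofNat_of_zero_le (Int.emod_nonneg x hb0.ne')
  have hkb : (k : ℤ) < b := hk ▸ Int.emod_lt_of_pos x hb0
  have hxi : x = i * b + k := by
    rw [← hmod, hk, hi]
    ring
  have hmem : i ∈ Finset.Icc (-M : ℤ) M := by
    rw [Finset.mem_Icc]
    constructor
    · exact (Int.le_ediv_iff_mul_le hb0).2 (by linarith)
    · exact (Int.ediv_lt_of_lt_mul hb0 (by linarith)).le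
  have h1 := Finset.single_le_sum (f := fun i : ℤ =>
    |potential D (i * (b : ℕ)) - c * (i * (b : ℕ) : ℤ)|) (fun _ _ => abs_nonneg _) hmem
  have h2 := abs_potential_add_sub_le hC (i * b) k
  have hC0 : 0 ≤ C := (abs_nonneg _).trans hc
  have hkb' : (k : ℝ) ≤ b := by exact_mod_cast hkb.le
  have h3 : |c * k| ≤ C * k := by
    rw [abs_mul, Nat.abs_cast]
    gcongr
  have h4 : C * k ≤ C * b := by gcongr
  have e : potential D x - c * x = (potential D (i * b) - c * (i * b : ℤ)) +
      (potential D (i * b + k) - potential D (i * b)) + -(c * k) := by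
    rw [hxi]
    push_cast
    ring
  rw [e]
  refine (abs_add_three _ _ _).trans ?_
  rw [abs_neg]
  linarith

/-! ### Moment bounds for potentials of independent environments -/

theorem measurable_crossTime {E : Type*} [MeasurableSpace E] {r : E → ℤ → ℝ}
    (hr : ∀ x, Measurable fun e => r e x) (j : ℕ) (x : ℤ) :
    Measurable fun e => crossTime (r e) j x := by
  induction j generalizing x with
  | zero => exact measurable_const
  | succ j ih => exact (measurable_const.add (hr x)).add ((hr x).mul (ih (x - 1)))

section

variable {E : Type*} [MeasurableSpace E] {P : Measure E}

theorem indepFun_crossTime {r : ℤ → E → ℝ} (hi : iIndepFun r P) (hr : ∀ x, Measurable (r x))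
    {j k : ℕ} {x y : ℤ} (hxy : x + k ≤ y) :
    IndepFun (fun e => crossTime (fun z => r z e) j x) (fun e => crossTime (fun z => r z e) k y)
      P := by
  classical
  have hd : Disjoint (Finset.Ioc (x - j) x) (Finset.Ioc (y - k) y) := by
    rw [Finset.disjoint_left]
    intro z h1 h2
    rw [Finset.mem_Ioc] at h1 h2
    omega
  -- Each crossing time is a function of its own window; the value 0 outside the window is never
  -- read.
  let φ (i : ℕ) (w : ℤ) (u : Finset.Ioc (w - i) w → ℝ) : ℝ :=
    crossTime (fun z => if h : z ∈ Finset.Ioc (w - i) w then u ⟨z, h⟩ else 0) i w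
  have hφ : ∀ i w, Measurable (φ i w) := fun i w =>
    measurable_crossTime (fun z => by
      by_cases h : z ∈ Finset.Ioc (w - i) w
      · simp only [h, dif_pos]
        exact measurable_pi_apply _
      · simp only [h, dif_neg, not_false_eq_true]
        exact measurable_const) i w
  have he : ∀ (i : ℕ) (w : ℤ), (fun e => crossTime (fun z => r z e) i w) =
      φ i w ∘ fun e (z : Finset.Ioc (w - i) w) => r z e := fun i w => by
    ext e
    exact crossTime_congr fun z hz => by simp only [hz, dif_pos]
  rw [he, he]
  exact (hi.indepFun_finset _ _ hd hr).comp (hφ j x) (hφ k y)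

theorem integral_crossTime [IsProbabilityMeasure P] {r : ℤ → E → ℝ} (hi : iIndepFun r P)
    (hr : ∀ x, Measurable (r x)) (hint : ∀ x, Integrable (r x) P) {c : ℝ}
    (hc : ∀ x, ∫ e, r x e ∂P = c) (j : ℕ) (x : ℤ) :
    Integrable (fun e => crossTime (fun z => r z e) j x) P ∧
      ∫ e, crossTime (fun z => r z e) j x ∂P = crossMean c j := by
  induction j generalizing x with
  | zero => simp [crossTime_zero, crossMean]
  | succ j ih =>
    obtain ⟨hI, hE⟩ := ih (x - 1)
    have hind : IndepFun (r x) (fun e => crossTime (fun z => r z e) j (x - 1)) P := by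
      -- The ratio at x is the depth-one crossing time minus 1, so independence of disjoint windows
      -- covers it.
      have h := (indepFun_crossTime hi hr (j := j) (k := 1) (x := x - 1) (y := x)
        (by simp)).symm.comp (measurable_id.sub_const 1) measurable_id
      convert h using 1
      · ext e
        simp [crossTime]
      · rfl
    have hmul := hind.integrable_mul (hint x) hI
    have hval := hind.integral_mul_eq_mul_integral (hint x).aestronglyMeasurable
      hI.aestronglyMeasurable
    have h1 : Integrable (fun e => 1 + r x e) P := (integrable_const 1).add (hint x)
    refine ⟨h1.add hmul, ?_⟩
    simp only [crossTime_succ, crossMean_succ]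
    have e := integral_add h1 hmul
    simp only [Pi.mul_apply] at e hval
    rw [e, hval, integral_add (integrable_const 1) (hint x), hc, hE]
    simp

theorem integrable_sq_sum [IsFiniteMeasure P] {d : ℤ → E → ℝ} (hd : ∀ y, Measurable (d y))
    {C : ℝ} (hC : ∀ y e, |d y e| ≤ C) (s : Finset ℤ) :
    Integrable (fun e => (∑ y ∈ s, d y e) ^ 2) P := by
  have h : Measurable fun e => (∑ y ∈ s, d y e) ^ 2 :=
    (Finset.measurable_fun_sum s fun y _ => hd y).pow_const 2
  refine Integrable.of_bound h.aestronglyMeasurable ((s.card * C) ^ 2)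
    (Eventually.of_forall fun e => ?_)
  rw [norm_pow, Real.norm_eq_abs]
  refine pow_le_pow_left₀ (abs_nonneg _) ((Finset.abs_sum_le_sum_abs _ _).trans ?_) 2
  simpa using Finset.sum_le_card_nsmul s _ C fun y _ => hC y e

/-- A finite-range dependent, centred and bounded sequence has linearly growing variance. -/
theorem integral_sq_sum_le [IsProbabilityMeasure P] {d : ℤ → E → ℝ}
    (hd : ∀ y, Measurable (d y)) {C : ℝ} (hC : ∀ y e, |d y e| ≤ C) {j : ℕ}
    (hcov : ∀ y z : ℤ, y + j ≤ z → ∫ e, d y e * d z e ∂P = 0) (a : ℤ) (n : ℕ) :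
    ∫ e, (∑ y ∈ Finset.Ico a (a + n), d y e) ^ 2 ∂P ≤ (2 * j + 1) * C ^ 2 * n := by
  have hint : ∀ y z, Integrable (fun e => d y e * d z e) P := fun y z =>
    Integrable.of_bound ((hd y).mul (hd z)).aestronglyMeasurable (C * C)
      (Eventually.of_forall fun e => by
        rw [norm_mul]
        exact mul_le_mul (hC y e) (hC z e) (norm_nonneg _) ((abs_nonneg _).trans (hC y e)))
  have hle : ∀ y z, ∫ e, d y e * d z e ∂P ≤ C ^ 2 := fun y z => by
    refine (integral_mono (hint y z) (integrable_const (C ^ 2)) fun e => ?_).trans (by simp)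
    refine (le_abs_self _).trans ?_
    rw [abs_mul, sq]
    exact mul_le_mul (hC y e) (hC z e) (abs_nonneg _) ((abs_nonneg _).trans (hC y e))
  have hsq := integrable_sq_sum (P := P) hd hC
  induction n with
  | zero => simp
  | succ n ih =>
    set b := a + n
    have hIco : Finset.Ico a (a + (n + 1 : ℕ)) = insert b (Finset.Ico a b) := by
      ext
      simp only [Finset.mem_Ico, Finset.mem_insert, b]
      push_cast
      omega
    have hcross : Integrable (fun e => ∑ y ∈ Finset.Ico a b, d y e * d b e) P :=
      integrable_finsetSum _ fun y _ => hint y b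
    have hexp : ∀ e, (∑ y ∈ Finset.Ico a (a + (n + 1 : ℕ)), d y e) ^ 2 =
        (∑ y ∈ Finset.Ico a b, d y e) ^ 2 + 2 * ∑ y ∈ Finset.Ico a b, d y e * d b e +
          d b e * d b e := fun e => by
      rw [hIco, Finset.sum_insert (by simp), ← Finset.sum_mul]
      ring
    have hsum : ∑ y ∈ Finset.Ico a b, ∫ e, d y e * d b e ∂P ≤ j * C ^ 2 := by
      -- At most `j` sites to the left of `b` are within the range of dependence; all others have
      -- zero covariance with it.
      calc ∑ y ∈ Finset.Ico a b, ∫ e, d y e * d b e ∂P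
          ≤ ∑ y ∈ Finset.Ico a b, if b < y + j then C ^ 2 else 0 := by
            refine Finset.sum_le_sum fun y _ => ?_
            split_ifs with h
            · exact hle y b
            · exact (hcov y b (not_lt.1 h)).le
        _ = ((Finset.Ico a b).filter fun y => b < y + j).card * C ^ 2 := by
            rw [← Finset.sum_filter, Finset.sum_const, nsmul_eq_mul]
        _ ≤ j * C ^ 2 := by
            have : ((Finset.Ico a b).filter fun y => b < y + j).card ≤
                (Finset.Ico (b - j) b).card := Finset.card_le_card fun y hy => by
              simp only [Finset.mem_filter, Finset.mem_Ico] at hy ⊢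
              omega
            rw [Int.card_Ico, sub_sub_cancel, Int.toNat_natCast] at this
            gcongr
    simp only [hexp]
    have h1 : Integrable (fun e => (∑ y ∈ Finset.Ico a b, d y e) ^ 2 +
        2 * ∑ y ∈ Finset.Ico a b, d y e * d b e) P := (hsq _).add (hcross.const_mul 2)
    rw [integral_add h1 (hint b b), integral_add (hsq _) (hcross.const_mul 2),
      integral_const_mul, integral_finsetSum _ fun y _ => hint y b]
    push_cast
    linarith [hle b b]

/-- The interval depends on z alone, so a single choice serves all realisations of a random `D`. -/
theorem abs_potential_sub_eq (z : ℤ) : ∃ a : ℤ, ∀ (D : ℤ → ℝ) (c : ℝ),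
    |potential D z - c * z| = |∑ y ∈ Finset.Ico a (a + z.natAbs), (D y - c)| := by
  rcases le_total 0 z with hz | hz
  · refine ⟨0, fun D c => ?_⟩
    obtain ⟨n, rfl⟩ := Int.eq_ofNat_of_zero_le hz
    rw [potential_of_nonneg D hz]
    simp [Finset.sum_sub_distrib, mul_comm]
  · refine ⟨z, fun D c => ?_⟩
    obtain ⟨n, hn⟩ := Int.eq_ofNat_of_zero_le (neg_nonneg.2 hz)
    obtain rfl : z = -n := by omega
    rw [potential_of_nonpos D hz, ← abs_neg]
    simp [Finset.sum_sub_distrib, mul_comm]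
    ring_nf

theorem integrable_potential {D : ℤ → E → ℝ} (hD : ∀ y, Integrable (D y) P) (z : ℤ) :
    Integrable (fun e => potential (fun y => D y e) z) P :=
  (integrable_finsetSum _ fun y _ => hD y).sub (integrable_finsetSum _ fun y _ => hD y)

theorem integrable_gridBound [IsFiniteMeasure P] {D : ℤ → E → ℝ} (hD : ∀ y, Integrable (D y) P)
    (c C : ℝ) (M t : ℕ) : Integrable (fun e => gridBound (fun y => D y e) c C M t) P :=
  (integrable_finsetSum _ fun _ _ =>
    ((integrable_potential hD _).sub (integrable_const _)).abs).add (integrable_const _)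

theorem integral_gridBound_le [IsProbabilityMeasure P] {D : ℤ → E → ℝ}
    (hD : ∀ y, Measurable (D y)) {c C : ℝ} (hC : ∀ y e, |D y e - c| ≤ C) {j : ℕ}
    (hcov : ∀ y z : ℤ, y + j ≤ z → ∫ e, (D y e - c) * (D z e - c) ∂P = 0) {a : ℝ} (ha : 0 < a)
    (M t : ℕ) :
    ∫ e, gridBound (fun y => D y e) c C M t ∂P ≤
      (2 * M + 1) * (a + a⁻¹ * ((2 * j + 1) * C ^ 2 * (M * (t / M + 1 : ℕ)))) +
        2 * C * (t / M + 1 : ℕ) := by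
  have hDi : ∀ y, Integrable (D y) P := fun y =>
    Integrable.of_bound (hD y).aestronglyMeasurable (C + |c|) (Eventually.of_forall fun e => by
      have := abs_add_le (D y e - c) c
      rw [sub_add_cancel] at this
      exact this.trans (add_le_add_left (hC y e) _))
  have hpt : ∀ z : ℤ, ∫ e, |potential (fun y => D y e) z - c * z| ∂P ≤
      a + a⁻¹ * ((2 * j + 1) * C ^ 2 * z.natAbs) := by
    intro z
    obtain ⟨b, hb⟩ := abs_potential_sub_eq z
    have hbd := integral_sq_sum_le (d := fun y e => D y e - c) (fun y => (hD y).sub_const c) hC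
      hcov b z.natAbs
    have hi2 := integrable_sq_sum (P := P) (fun y => (hD y).sub_const c) hC
      (Finset.Ico b (b + z.natAbs))
    calc ∫ e, |potential (fun y => D y e) z - c * z| ∂P
        ≤ ∫ e, (a + a⁻¹ * (∑ y ∈ Finset.Ico b (b + z.natAbs), (D y e - c)) ^ 2) ∂P := by
          refine integral_mono (((integrable_potential hDi z).sub (integrable_const _)).abs)
            ((integrable_const a).add (hi2.const_mul _)) fun e => ?_
          simp only [hb]
          exact abs_le_add_inv_mul_sq ha _
      _ ≤ _ := by
          rw [integral_add (integrable_const a) (hi2.const_mul _), integral_const_mul]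
          simp only [integral_const, probReal_univ, one_smul]
          gcongr
  unfold gridBound
  have hi : ∀ i : ℤ, Integrable (fun e =>
      |potential (fun y => D y e) (i * (t / M + 1 : ℕ)) - c * (i * (t / M + 1 : ℕ) : ℤ)|) P :=
    fun i => ((integrable_potential hDi _).sub (integrable_const _)).abs
  rw [integral_add (integrable_finsetSum _ fun i _ => hi i) (integrable_const _),
    integral_finsetSum _ fun i _ => hi i]
  simp only [integral_const, probReal_univ, one_smul]
  gcongr
  refine (Finset.sum_le_card_nsmul _ _
    (a + a⁻¹ * ((2 * j + 1) * C ^ 2 * (M * (t / M + 1 : ℕ)))) fun i hi => ?_).trans ?_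
  · refine (hpt _).trans ?_
    have : ((i * (t / M + 1 : ℕ) : ℤ).natAbs : ℝ) ≤ M * (t / M + 1 : ℕ) := by
      rw [Int.natAbs_mul, Int.natAbs_natCast]
      push_cast
      have : i.natAbs ≤ M := by
        rw [Finset.mem_Icc] at hi
        omega
      gcongr
    gcongr
  · rw [Int.card_Icc, nsmul_eq_mul]
    apply le_of_eq
    congr 1
    have : ((M : ℤ) + 1 - -M).toNat = 2 * M + 1 := by omega
    rw [this]
    push_cast
    ring

end

theorem exists_gridBound_parameters {C L ε : ℝ} (hC : 0 ≤ C) (hL : 0 ≤ L) (hε : 0 < ε) :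
    -- Order of choice: `M` first, to make the mesh error 2 C t / M small; then `a`, depending on
    -- `M`, to absorb the variance term; `A` collects what does not grow with `t`.
    ∃ M : ℕ, 0 < M ∧ ∃ a : ℝ, 0 < a ∧ ∃ A : ℝ, ∀ t : ℕ,
      (2 * M + 1) * (a + a⁻¹ * (L * (M * (t / M + 1 : ℕ)))) + 2 * C * (t / M + 1 : ℕ) ≤
        ε * t + A := by
  obtain ⟨M, hM⟩ := exists_nat_gt (4 * C / ε)
  have hM0 : (0 : ℝ) < M := lt_of_le_of_lt (by positivity) hM
  have hMC : 2 * C ≤ ε / 2 * M := by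
    rw [div_lt_iff₀ hε] at hM
    linarith
  set a : ℝ := (2 * M + 1) * L / (ε / 2) + 1
  have ha : 0 < a := by positivity
  have haL : (2 * M + 1) * L * a⁻¹ ≤ ε / 2 := by
    rw [← div_eq_mul_inv, div_le_iff₀ ha]
    have : ε / 2 * a = (2 * M + 1) * L + ε / 2 := by
      simp only [a]
      field_simp
    linarith
  refine ⟨M, by exact_mod_cast hM0, a, ha, (2 * M + 1) * a + ε / 2 * M + 2 * C, fun t => ?_⟩
  set b : ℝ := ((t / M + 1 : ℕ) : ℝ)
  have hb : M * b ≤ t + M := by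
    have : M * (t / M + 1) ≤ t + M := by
      rw [mul_add, mul_one]
      exact Nat.add_le_add_right (Nat.mul_div_le t M) M
    simp only [b]
    exact_mod_cast this
  have hb0 : 0 ≤ M * b := by positivity
  have h1 := mul_le_mul haL hb hb0 (by positivity)
  have h2 : 2 * C * (b - 1) ≤ ε / 2 * t := by
    have hb1 : 0 ≤ b - 1 := by simp [b]
    calc 2 * C * (b - 1) ≤ ε / 2 * M * (b - 1) := by gcongr
      _ = ε / 2 * (M * b - M) := by ring
      _ ≤ ε / 2 * t := by gcongr; linarith
  have e : (2 * M + 1) * (a + a⁻¹ * (L * (M * b))) =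
    (2 * M + 1) * a + (2 * M + 1) * L * a⁻¹ * (M * b) := by ring
  rw [e]
  linarith

/-! ### The static walk -/

theorem measurable_rho : Measurable rho := by
  unfold rho
  fun_prop

/-- The random space environment `ξ` is i.i.d. with site law `α` under `P`. -/
structure IsIIDEnv (α : Measure (Set.Ioo (0 : ℝ) 1)) {E : Type} [MeasurableSpace E]
    (P : Measure E) (ξ : E → SpaceEnv) : Prop where
  indep : iIndepFun (fun x e => ξ e x) P
  meas : ∀ x, Measurable fun e => ξ e x
  law : ∀ x, P.map (fun e => ξ e x) = α

/-- The mean of `min ρ K`. -/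
noncomputable def truncMeanRho (α : Measure (Set.Ioo (0 : ℝ) 1)) (K : ℝ) : ℝ :=
  ∫ p, min (rho p) K ∂α

section

variable {α : Measure (Set.Ioo (0 : ℝ) 1)}

theorem truncMeanRho_eq (K : ℝ) (hK : 0 ≤ K) :
    truncMeanRho α K = (∫⁻ p, ENNReal.ofReal (min (rho p) K) ∂α).toReal :=
  integral_eq_lintegral_of_nonneg_ae
    (Eventually.of_forall fun p => le_min (rho_pos p).le hK)
    (measurable_rho.min measurable_const).aestronglyMeasurable

theorem truncMeanRho_nonneg {K : ℝ} (hK : 0 ≤ K) : 0 ≤ truncMeanRho α K :=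
  integral_nonneg fun p => le_min (rho_pos p).le hK

theorem lintegral_min_rho_lt_top [IsProbabilityMeasure α] (K : ℝ) :
    ∫⁻ p, ENNReal.ofReal (min (rho p) K) ∂α < ⊤ :=
  (lintegral_mono fun p => ENNReal.ofReal_le_ofReal (min_le_right _ _)).trans_lt (by simp)

theorem truncMeanRho_le [IsProbabilityMeasure α] {K : ℝ} (hK : 0 ≤ K) : truncMeanRho α K ≤ K := by
  refine (integral_mono_of_nonneg (Eventually.of_forall fun p => le_min (rho_pos p).le hK)
    (integrable_const K) (Eventually.of_forall fun p => min_le_right _ _)).trans (by simp)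

theorem tendsto_lintegral_min_rho :
    Tendsto (fun K : ℕ => ∫⁻ p, ENNReal.ofReal (min (rho p) K) ∂α) atTop (nhds (meanRho α)) := by
  refine lintegral_tendsto_of_tendsto_of_monotone
    (fun K => (measurable_rho.min measurable_const).ennreal_ofReal.aemeasurable)
    (Eventually.of_forall fun p => ?_) (Eventually.of_forall fun p => ?_)
  · intro K K' h
    exact ENNReal.ofReal_le_ofReal (min_le_min_left _ (by exact_mod_cast h))
  · refine tendsto_const_nhds.congr' ?_
    obtain ⟨N, hN⟩ := exists_nat_ge (rho p)
    filter_upwards [eventually_ge_atTop N] with K hK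
    rw [min_eq_left (hN.trans (by exact_mod_cast hK))]

theorem truncMeanRho_le_toReal (h : meanRho α < 1) {K : ℝ} (hK : 0 ≤ K) :
    truncMeanRho α K ≤ (meanRho α).toReal := by
  rw [truncMeanRho_eq K hK]
  exact ENNReal.toReal_mono h.ne_top
    (lintegral_mono fun p => ENNReal.ofReal_le_ofReal (min_le_left _ _))

theorem toReal_meanRho_lt_one (h : meanRho α < 1) : (meanRho α).toReal < 1 := by
  simpa using (ENNReal.toReal_lt_toReal h.ne_top ENNReal.one_ne_top).2 h

theorem crossMean_le_limit {r : ℝ} (h0 : 0 ≤ r) (h1 : r < 1) (j : ℕ) :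
    crossMean r j ≤ (1 + r) / (1 - r) := by
  rw [crossMean_eq h1.ne]
  have : 0 < 1 - r := by linarith
  exact mul_le_of_le_one_right (by positivity) (by linarith [pow_nonneg h0 j])

theorem one_le_crossMean {c : ℝ} (hc : 0 ≤ c) {J : ℕ} (hJ : 0 < J) : 1 ≤ crossMean c J := by
  obtain ⟨j, rfl⟩ : ∃ j, J = j + 1 := ⟨J - 1, by omega⟩
  have := mul_nonneg hc (crossMean_nonneg hc j)
  rw [crossMean_succ]
  linarith

theorem exists_crossMean_gt_limit (h : meanRho α < 1) {ε : ℝ} (hε : 0 < ε) :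
    ∃ K J : ℕ, 0 < J ∧ (1 + (meanRho α).toReal) / (1 - (meanRho α).toReal) - ε <
      crossMean (truncMeanRho α K) J := by
  set r := (meanRho α).toReal
  have hr1 : r < 1 := toReal_meanRho_lt_one h
  have hr0 : 0 ≤ r := ENNReal.toReal_nonneg
  have hJ : Tendsto (fun j => crossMean r j) atTop (nhds ((1 + r) / (1 - r))) := by
    simp only [crossMean_eq hr1.ne]
    simpa using ((tendsto_pow_atTop_nhds_zero_of_lt_one hr0 hr1).const_sub 1).const_mul
      ((1 + r) / (1 - r))
  obtain ⟨J, hJ1, hJ0⟩ := ((hJ.eventually_const_lt (sub_lt_self _ hε)).and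
    (eventually_gt_atTop 0)).exists
  have hK : Tendsto (fun K : ℕ => truncMeanRho α K) atTop (nhds r) := by
    simp only [truncMeanRho_eq _ (Nat.cast_nonneg _)]
    exact (ENNReal.tendsto_toReal h.ne_top).comp tendsto_lintegral_min_rho
  obtain ⟨K, hK⟩ := ((((continuous_crossMean J).tendsto r).comp hK).eventually_const_lt hJ1).exists
  exact ⟨K, J, hJ0, hK⟩

/-- At ratio 1 the crossing mean is 2 J, hence unbounded. A ratio `s` slightly below 1 is still
enough by continuity, and capped means exceed such an `s` even if ⟨ρ⟩ = 1 or ⟨ρ⟩ = ∞. -/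
theorem exists_crossMean_gt [IsProbabilityMeasure α] (h : 1 ≤ meanRho α) (B : ℝ) :
    ∃ K J : ℕ, 0 < J ∧ B < crossMean (truncMeanRho α K) J := by
  obtain ⟨J, hJ⟩ := exists_nat_gt (max B 0)
  have hJ0 : 0 < J := by exact_mod_cast (le_max_right B 0).trans_lt hJ
  have hJB : B < crossMean 1 J := by
    rw [crossMean_one]
    linarith [(le_max_left B 0).trans_lt hJ, (Nat.cast_nonneg J : (0 : ℝ) ≤ J)]
  have h1 := ((continuous_crossMean J).tendsto 1).eventually_const_lt hJB
  obtain ⟨s, hs, hs0, hs1⟩ := ((h1.filter_mono nhdsWithin_le_nhds).and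
    (Ioo_mem_nhdsLT (zero_lt_one' ℝ))).exists
  have hs' : ENNReal.ofReal s < meanRho α :=
    lt_of_lt_of_le (by simpa using (ENNReal.ofReal_lt_ofReal_iff one_pos).2 hs1) h
  obtain ⟨K, hK⟩ := (tendsto_lintegral_min_rho.eventually_const_lt hs').exists
  refine ⟨K, J, hJ0, hs.trans_le (crossMean_mono hs0.le ?_ le_rfl)⟩
  rw [truncMeanRho_eq _ (Nat.cast_nonneg _)]
  exact (ENNReal.ofReal_le_iff_le_toReal (lintegral_min_rho_lt_top _).ne).1 hK.le

theorem staticSpeed_of_lt (h : meanRho α < 1) :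
    staticSpeed α = ((1 + (meanRho α).toReal) / (1 - (meanRho α).toReal))⁻¹ := by
  rw [staticSpeed, if_pos h, inv_div]

theorem staticSpeed_of_le (h : 1 ≤ meanRho α) : staticSpeed α = 0 := by
  rw [staticSpeed, if_neg h.not_gt]

theorem exists_crossMean_inv_le [IsProbabilityMeasure α] {ε : ℝ} (hε : 0 < ε) :
    ∃ K J : ℕ, 0 < J ∧ (crossMean (truncMeanRho α K) J)⁻¹ ≤ staticSpeed α + ε := by
  rcases lt_or_ge (meanRho α) 1 with h | h
  · obtain ⟨K, J, hJ, hlt⟩ := exists_crossMean_gt_limit h hε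
    refine ⟨K, J, hJ, ?_⟩
    rw [staticSpeed_of_lt h]
    have hc := one_le_crossMean (truncMeanRho_nonneg (α := α) (Nat.cast_nonneg K)) hJ
    have hr1 := toReal_meanRho_lt_one h
    have hr0 : 0 ≤ (meanRho α).toReal := ENNReal.toReal_nonneg
    generalize crossMean (truncMeanRho α K) J = c at *
    have hL : 1 ≤ (1 + (meanRho α).toReal) / (1 - (meanRho α).toReal) := by
      rw [le_div_iff₀ (by linarith)]
      linarith
    generalize (1 + (meanRho α).toReal) / (1 - (meanRho α).toReal) = L at *
    rw [inv_le_iff_one_le_mul₀ (by linarith)]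
    have h1 : L⁻¹ * L = 1 := inv_mul_cancel₀ (by linarith)
    have h2 : L⁻¹ ≤ 1 := inv_le_one_of_one_le₀ hL
    have h3 : 0 < L⁻¹ := by positivity
    nlinarith [mul_le_mul_of_nonneg_left hlt.le h3.le]
  · obtain ⟨K, J, hJ, hlt⟩ := exists_crossMean_gt h ε⁻¹
    refine ⟨K, J, hJ, ?_⟩
    rw [staticSpeed_of_le h, zero_add]
    exact inv_le_of_inv_le₀ hε hlt.le

theorem staticSpeed_le_inv_crossMean {K J : ℕ} (hJ : 0 < J) :
    staticSpeed α ≤ (crossMean (truncMeanRho α K) J)⁻¹ := by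
  have hc0 := truncMeanRho_nonneg (α := α) (Nat.cast_nonneg K)
  have hc := one_le_crossMean hc0 hJ
  rcases lt_or_ge (meanRho α) 1 with h | h
  · rw [staticSpeed_of_lt h]
    refine inv_anti₀ (by linarith) ((crossMean_mono hc0 (truncMeanRho_le_toReal h
      (Nat.cast_nonneg K)) le_rfl).trans ?_)
    exact crossMean_le_limit ENNReal.toReal_nonneg (toReal_meanRho_lt_one h) J
  · rw [staticSpeed_of_le h]
    positivity

end

section

variable {α : Measure (Set.Ioo (0 : ℝ) 1)} {E : Type} [MeasurableSpace E] {P : Measure E}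
  {ξ : E → SpaceEnv}

theorem IsIIDEnv.reflect (h : IsIIDEnv α P ξ) :
    IsIIDEnv (α.map reflectSite) P fun e x => reflectSite (ξ e (-x)) where
  indep := (h.indep.precomp neg_injective).comp (fun _ => reflectSite)
    fun _ => measurable_reflectSite
  meas x := measurable_reflectSite.comp (h.meas (-x))
  law x := by
    rw [← h.law (-x), Measure.map_map measurable_reflectSite (h.meas _)]
    rfl

theorem IsIIDEnv.translate (h : IsIIDEnv α P ξ) (y : ℤ) :
    IsIIDEnv α P fun e x => ξ e (x + y) where
  indep := h.indep.precomp (add_left_injective y)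
  meas _ := h.meas _
  law _ := h.law _

/-- Truncated mean crossing times in the environment `ω`, with ratios capped at `K`. -/
noncomputable def truncCrossTime (K : ℝ) (J : ℕ) (ω : SpaceEnv) (x : ℤ) : ℝ :=
  crossTime (fun y => min (rho (ω y)) K) J x

theorem truncCrossTime_nonneg {K : ℝ} (hK : 0 ≤ K) (J : ℕ) (ω : SpaceEnv) (x : ℤ) :
    0 ≤ truncCrossTime K J ω x :=
  crossTime_nonneg (fun _ => le_min (rho_pos _).le hK) J x

theorem truncCrossTime_le {K : ℝ} (hK : 0 ≤ K) (J : ℕ) (ω : SpaceEnv) (x : ℤ) :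
    truncCrossTime K J ω x ≤ crossMean K J :=
  crossTime_le_crossMean (fun _ => le_min (rho_pos _).le hK) (fun _ => min_le_right _ _) J x

/-- Both truncations err in the same direction: one more level of depth and removing the cap at x
can only increase the right-hand side. Hence a subsolution. -/
theorem truncCrossTime_step {K : ℝ} (hK : 0 ≤ K) (J : ℕ) (ω : SpaceEnv) (x : ℤ) :
    truncCrossTime K J ω x ≤ 1 + rho (ω x) + rho (ω x) * truncCrossTime K J ω (x - 1) := by
  have h0 : ∀ y, 0 ≤ min (rho (ω y)) K := fun y => le_min (rho_pos _).le hK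
  refine (crossTime_mono h0 (fun _ => le_rfl) J.le_succ x).trans ?_
  rw [crossTime_succ]
  have := min_le_left (rho (ω x)) K
  have := crossTime_nonneg h0 J (x - 1)
  unfold truncCrossTime
  gcongr

theorem IsIIDEnv.integral_comp (h : IsIIDEnv α P ξ) {f : Set.Ioo (0 : ℝ) 1 → ℝ}
    (hf : Measurable f) (x : ℤ) : ∫ e, f (ξ e x) ∂P = ∫ p, f p ∂α := by
  rw [← h.law x, integral_map (h.meas x).aemeasurable hf.aestronglyMeasurable]

theorem IsIIDEnv.indep_comp (h : IsIIDEnv α P ξ) {f : Set.Ioo (0 : ℝ) 1 → ℝ}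
    (hf : Measurable f) : iIndepFun (fun x e => f (ξ e x)) P :=
  h.indep.comp (fun _ => f) fun _ => hf

theorem IsIIDEnv.integrable_rho (h : IsIIDEnv α P ξ) (hα : meanRho α < 1) (x : ℤ) :
    Integrable (fun e => rho (ξ e x)) P := by
  refine ⟨(measurable_rho.comp (h.meas x)).aestronglyMeasurable, ?_⟩
  rw [hasFiniteIntegral_iff_ofReal (Eventually.of_forall fun e => (rho_pos _).le)]
  have := lintegral_map (μ := P) measurable_rho.ennreal_ofReal (h.meas x)
  rw [h.law x] at this
  rw [← this]
  exact hα.trans_le le_top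

theorem IsIIDEnv.integral_rho (h : IsIIDEnv α P ξ) (x : ℤ) :
    ∫ e, rho (ξ e x) ∂P = (meanRho α).toReal := by
  rw [h.integral_comp measurable_rho]
  exact integral_eq_lintegral_of_nonneg_ae (Eventually.of_forall fun p => (rho_pos p).le)
    measurable_rho.aestronglyMeasurable

variable [IsProbabilityMeasure P]

theorem IsIIDEnv.truncCrossTime_mean (h : IsIIDEnv α P ξ) {K : ℝ} (hK : 0 ≤ K) (J : ℕ) (x : ℤ) :
    Integrable (fun e => truncCrossTime K J (ξ e) x) P ∧
      ∫ e, truncCrossTime K J (ξ e) x ∂P = crossMean (truncMeanRho α K) J := by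
  have hm : Measurable fun p => min (rho p) K := measurable_rho.min measurable_const
  refine integral_crossTime (r := fun x e => min (rho (ξ e x)) K) (h.indep_comp hm)
    (fun x => hm.comp (h.meas x)) (fun x => ?_) (fun x => h.integral_comp hm x) J x
  refine Integrable.of_bound (hm.comp (h.meas x)).aestronglyMeasurable K
    (Eventually.of_forall fun e => ?_)
  rw [Real.norm_eq_abs, abs_of_nonneg (le_min (rho_pos _).le hK)]
  exact min_le_right _ _

theorem IsIIDEnv.integral_gridBound_le (h : IsIIDEnv α P ξ) [IsProbabilityMeasure α]
    {K : ℝ} (hK : 0 ≤ K) (J : ℕ) {a : ℝ} (ha : 0 < a) (M t : ℕ) :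
    ∫ e, gridBound (truncCrossTime K J (ξ e)) (crossMean (truncMeanRho α K) J) (crossMean K J)
      M t ∂P ≤ (2 * M + 1) * (a + a⁻¹ * ((2 * J + 1) * crossMean K J ^ 2 *
        (M * (t / M + 1 : ℕ)))) + 2 * crossMean K J * (t / M + 1 : ℕ) := by
  have hm : Measurable fun p => min (rho p) K := measurable_rho.min measurable_const
  have hD : ∀ y, Measurable fun e => truncCrossTime K J (ξ e) y := fun y =>
    measurable_crossTime (fun x => hm.comp (h.meas x)) J y
  have h0 := truncMeanRho_nonneg (α := α) hK
  refine RWCRE.integral_gridBound_le (D := fun y e => truncCrossTime K J (ξ e) y) hD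
    (fun y e => abs_le.2 ⟨?_, ?_⟩) (j := J) (fun y z hyz => ?_) ha M t
  · linarith [truncCrossTime_nonneg hK J (ξ e) y,
      crossMean_mono h0 (truncMeanRho_le (α := α) hK) (le_refl J)]
  · linarith [truncCrossTime_le hK J (ξ e) y, crossMean_nonneg h0 J]
  · have hind := (indepFun_crossTime (h.indep_comp hm) (fun x => hm.comp (h.meas x))
      (j := J) hyz).comp (measurable_id.sub_const (crossMean (truncMeanRho α K) J))
        (measurable_id.sub_const (crossMean (truncMeanRho α K) J))
    have hE := hind.integral_fun_mul_eq_mul_integral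
      ((hD y).sub_const _).aestronglyMeasurable ((hD z).sub_const _).aestronglyMeasurable
    refine hE.trans ?_
    have hz : ∫ e, (truncCrossTime K J (ξ e) y - crossMean (truncMeanRho α K) J) ∂P = 0 := by
      rw [integral_sub (h.truncCrossTime_mean hK J y).1 (integrable_const _),
        (h.truncCrossTime_mean hK J y).2]
      simp
    exact mul_eq_zero_of_left hz _

end

/-- `M` and `A` depend only on the site law, the truncation and `ε`, so one choice serves every
block and every starting point of the cooling walk. -/
theorem exists_gridBound_le (α : Measure (Set.Ioo (0 : ℝ) 1)) [IsProbabilityMeasure α]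
    (K J : ℕ) {ε : ℝ} (hε : 0 < ε) :
    ∃ M : ℕ, 0 < M ∧ ∃ A : ℝ, ∀ {E : Type} [MeasurableSpace E] (P : Measure E)
      [IsProbabilityMeasure P] (ξ : E → SpaceEnv), IsIIDEnv α P ξ → ∀ t : ℕ,
      ∫ e, gridBound (truncCrossTime K J (ξ e)) (crossMean (truncMeanRho α K) J)
        (crossMean K J) M t ∂P ≤ ε * t + A := by
  have hK : (0 : ℝ) ≤ K := Nat.cast_nonneg K
  obtain ⟨M, hM, a, ha, A, h⟩ := exists_gridBound_parameters (crossMean_nonneg hK J)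
    (show 0 ≤ (2 * J + 1) * crossMean K J ^ 2 by positivity) hε
  exact ⟨M, hM, A, fun P _ ξ hξ t => (hξ.integral_gridBound_le hK J ha M t).trans (h t)⟩

theorem abs_potential_truncCrossTime_le {α : Measure (Set.Ioo (0 : ℝ) 1)}
    [IsProbabilityMeasure α] {K : ℝ} (hK : 0 ≤ K) (J : ℕ) {M : ℕ} (hM : 0 < M) (ω : SpaceEnv)
    {t : ℕ} {x : ℤ} (hx : |x| ≤ t) :
    |potential (truncCrossTime K J ω) x - crossMean (truncMeanRho α K) J * x| ≤
      gridBound (truncCrossTime K J ω) (crossMean (truncMeanRho α K) J) (crossMean K J) M t := by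
  have h0 := truncMeanRho_nonneg (α := α) hK
  refine abs_potential_sub_le_gridBound (fun x => ?_) ?_ hM hx
  · rw [abs_of_nonneg (truncCrossTime_nonneg hK J ω x)]
    exact truncCrossTime_le hK J ω x
  · rw [abs_of_nonneg (crossMean_nonneg h0 J)]
    exact crossMean_mono h0 (truncMeanRho_le hK) le_rfl

theorem IsIIDEnv.integrable_gridBound {α : Measure (Set.Ioo (0 : ℝ) 1)} {E : Type}
    [MeasurableSpace E] {P : Measure E} [IsProbabilityMeasure P] {ξ : E → SpaceEnv}
    (h : IsIIDEnv α P ξ) {K : ℝ} (hK : 0 ≤ K) (J : ℕ) (c C : ℝ) (M t : ℕ) :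
    Integrable (fun e => gridBound (truncCrossTime K J (ξ e)) c C M t) P :=
  RWCRE.integrable_gridBound (fun y => (h.truncCrossTime_mean hK J y).1) c C M t

/-- The static walk is asymptotically not faster than `staticSpeed α`. -/
theorem exists_static_upper (α : Measure (Set.Ioo (0 : ℝ) 1)) [IsProbabilityMeasure α]
    {ε : ℝ} (hε : 0 < ε) :
    ∃ A : ℝ, ∀ {E : Type} [MeasurableSpace E] (P : Measure E) [IsProbabilityMeasure P]
      (ξ : E → SpaceEnv), IsIIDEnv α P ξ → ∀ t : ℕ, ∃ B : E → ℝ, Integrable B P ∧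
      ∫ e, B e ∂P ≤ ε * t + A ∧
      ∀ e, walkMean (fun _ => ξ e) t (fun x => max (x - staticSpeed α * t) 0) 0 ≤ B e := by
  obtain ⟨K, J, hJ, hv⟩ := exists_crossMean_inv_le (α := α) (half_pos hε)
  have hK : (0 : ℝ) ≤ K := Nat.cast_nonneg K
  obtain ⟨M, hM, A, hA⟩ := exists_gridBound_le α K J (half_pos (half_pos hε))
  have hc1 := one_le_crossMean (truncMeanRho_nonneg (α := α) hK) hJ
  set c := crossMean (truncMeanRho α K) J with hc
  set C := crossMean (K : ℝ) J
  -- Chosen so that the martingale fluctuations cost at most (ε/4) t; the grid costs another ε/4 and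
  -- replacing 1/c by the speed the remaining ε/2.
  set a : ℝ := (C + 1) ^ 2 / (ε / 2 / 2) + 1
  have ha : 0 < a := by positivity
  have haC : a⁻¹ * (C + 1) ^ 2 ≤ ε / 2 / 2 := by
    rw [inv_mul_le_iff₀ ha]
    have : a * (ε / 2 / 2) = (C + 1) ^ 2 + ε / 2 / 2 := by
      simp only [a]
      field_simp
    linarith
  refine ⟨A + a, fun P _ ξ hξ t => ⟨fun e => gridBound (truncCrossTime K J (ξ e)) c C M t +
    (a + a⁻¹ * ((C + 1) ^ 2 * t) + ε / 2 * t),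
    (hξ.integrable_gridBound hK J c C M t).add (integrable_const _), ?_, fun e => ?_⟩⟩
  · rw [integral_add (hξ.integrable_gridBound hK J c C M t) (integrable_const _)]
    have h1 := hA P ξ hξ t
    have h2 : a⁻¹ * (C + 1) ^ 2 * t ≤ ε / 2 / 2 * t := by gcongr
    simp only [integral_const, probReal_univ, one_smul]
    linarith
  · have hD : ∀ x, |truncCrossTime K J (ξ e) x| ≤ C := fun x => by
      rw [abs_of_nonneg (truncCrossTime_nonneg hK J _ x)]
      exact truncCrossTime_le hK J _ x
    have hmax := walkMean_max_potential_le (ξ e) hD (truncCrossTime_step hK J (ξ e)) ha t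
    have hpt : ∀ x : ℤ, |x - 0| ≤ t → max (x - staticSpeed α * t) 0 ≤
        max (potential (truncCrossTime K J (ξ e)) x - t) 0 +
          (gridBound (truncCrossTime K J (ξ e)) c C M t + ε / 2 * t) := fun x hx => by
      rw [sub_zero] at hx
      have h1 := abs_le.1 (abs_potential_truncCrossTime_le (α := α) hK J hM (ξ e) hx)
      have hgrid := (abs_nonneg _).trans
        (abs_potential_truncCrossTime_le (α := α) hK J hM (ξ e) hx)
      rw [← hc] at h1 hgrid
      have hp := le_max_right (potential (truncCrossTime K J (ξ e)) x - t) 0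
      have hp' := le_max_left (potential (truncCrossTime K J (ξ e)) x - t) 0
      set G := gridBound (truncCrossTime K J (ξ e)) c C M t
      set p := max (potential (truncCrossTime K J (ξ e)) x - t) 0
      have ht : (0 : ℝ) ≤ t := Nat.cast_nonneg t
      refine max_le ?_ (by positivity)
      have h2 : c * x - t ≤ p + G := by linarith [h1.1]
      have h3 : x - c⁻¹ * t ≤ p + G := by
        have e1 : x - c⁻¹ * t = c⁻¹ * (c * x - t) := by field_simp
        rw [e1]
        refine (mul_le_mul_of_nonneg_left h2 (by positivity)).trans ?_
        exact mul_le_of_le_one_left (by positivity) (inv_le_one_of_one_le₀ hc1)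
      have h4 : c⁻¹ * t ≤ (staticSpeed α + ε / 2) * t := by gcongr
      linarith
    refine (walkMean_mono _ t hpt).trans ?_
    rw [walkMean_add, walkMean_const]
    linarith

/-- The static walk has asymptotically at least the mean speed `staticSpeed α` if `⟨ρ⟩ < 1`. -/
theorem exists_static_lower (α : Measure (Set.Ioo (0 : ℝ) 1)) [IsProbabilityMeasure α]
    (hα : meanRho α < 1) {ε : ℝ} (hε : 0 < ε) :
    ∃ A : ℝ, ∀ {E : Type} [MeasurableSpace E] (P : Measure E) [IsProbabilityMeasure P]
      (ξ : E → SpaceEnv), IsIIDEnv α P ξ → ∀ t : ℕ, ∃ B : E → ℝ, Integrable B P ∧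
      ∫ e, B e ∂P ≤ ε * t + A ∧
      ∀ e, staticSpeed α * t - walkMean (fun _ => ξ e) t (fun x => x) 0 ≤ B e := by
  obtain ⟨K, J, hJ, hL⟩ := exists_crossMean_gt_limit hα (half_pos hε)
  have hK : (0 : ℝ) ≤ K := Nat.cast_nonneg K
  obtain ⟨M, hM, A, hA⟩ := exists_gridBound_le α K J (half_pos hε)
  have hc1 := one_le_crossMean (truncMeanRho_nonneg (α := α) hK) hJ
  have hv := staticSpeed_le_inv_crossMean (α := α) (K := K) hJ
  set c := crossMean (truncMeanRho α K) J with hc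
  set C := crossMean (K : ℝ) J
  have hlim := crossMean_le_limit (r := (meanRho α).toReal) ENNReal.toReal_nonneg
    (toReal_meanRho_lt_one hα)
  set L := (1 + (meanRho α).toReal) / (1 - (meanRho α).toReal)
  refine ⟨A, fun {E} _ P _ ξ hξ t => ?_⟩
  -- The depth drops by exactly one from x to x - 1, so the recursion is exact at every x ≥ -t,
  -- where `toNat` does not truncate. The offset `J + 1` keeps the depth above `J` there, so that Δ
  -- dominates the truncated times.
  let Δ : E → ℤ → ℝ := fun e x => crossTime (fun y => rho (ξ e y)) (x + t + J + 1).toNat x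
  have hΔ : ∀ x, Integrable (fun e => Δ e x) P ∧ ∫ e, Δ e x ∂P ≤ L := fun x => by
    have := integral_crossTime (hξ.indep_comp measurable_rho)
      (fun x => measurable_rho.comp (hξ.meas x)) (hξ.integrable_rho hα) hξ.integral_rho
      (x + t + J + 1).toNat x
    exact ⟨this.1, this.2.trans_le (hlim _)⟩
  have hD : ∀ x, Integrable (fun e => truncCrossTime K J (ξ e) x) P ∧
      ∫ e, truncCrossTime K J (ξ e) x ∂P = c := hξ.truncCrossTime_mean hK J
  have hsumI : Integrable (fun e => ∑ y ∈ Finset.Ico (0 : ℤ) t,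
      (Δ e y - truncCrossTime K J (ξ e) y)) P :=
    integrable_finsetSum _ fun y _ => (hΔ y).1.sub (hD y).1
  have hgI := hξ.integrable_gridBound hK J c C M t
  refine ⟨fun e => gridBound (truncCrossTime K J (ξ e)) c C M t +
    ∑ y ∈ Finset.Ico (0 : ℤ) t, (Δ e y - truncCrossTime K J (ξ e) y), hgI.add hsumI, ?_,
    fun e => ?_⟩
  · have hdI : ∀ y, Integrable (fun e => Δ e y - truncCrossTime K J (ξ e) y) P :=
      fun y => (hΔ y).1.sub (hD y).1
    rw [integral_add hgI hsumI, integral_finsetSum _ fun y _ => hdI y]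
    have h1 := hA P ξ hξ t
    have h2 : ∑ y ∈ Finset.Ico (0 : ℤ) t, ∫ e, (Δ e y - truncCrossTime K J (ξ e) y) ∂P ≤
        t * (ε / 2) := by
      refine (Finset.sum_le_card_nsmul _ _ (ε / 2) fun y _ => ?_).trans (by simp)
      rw [integral_sub (hΔ y).1 (hD y).1, (hD y).2]
      linarith [(hΔ y).2]
    linarith
  · have hle : ∀ y, -(t : ℤ) ≤ y → truncCrossTime K J (ξ e) y ≤ Δ e y := fun y hy =>
      crossTime_mono (fun _ => le_min (rho_pos _).le hK) (fun _ => min_le_left _ _) (by omega) y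
    have hstep : ∀ x, -(t : ℤ) ≤ x → Δ e x = 1 + rho (ξ e x) + rho (ξ e x) * Δ e (x - 1) :=
      fun x hx => by
        simp only [Δ]
        rw [show (x + t + J + 1).toNat = (x - 1 + t + J + 1).toNat + 1 by omega, crossTime_succ]
    have hexact := walkMean_potential_eq (ξ e) hstep
    set S := ∑ y ∈ Finset.Ico (0 : ℤ) t, (Δ e y - truncCrossTime K J (ξ e) y)
    set G := gridBound (truncCrossTime K J (ξ e)) c C M t
    have hS : 0 ≤ S := Finset.sum_nonneg fun y hy => by
      rw [Finset.mem_Ico] at hy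
      exact sub_nonneg.2 (hle y (by omega))
    -- To the left of 0 the potential is minus a sum, so larger increments only help; the error `S`
    -- comes from [0, t) alone.
    have hpot : ∀ x : ℤ, |x - 0| ≤ t →
        potential (Δ e) x ≤ potential (truncCrossTime K J (ξ e)) x + S := fun x hx => by
      rw [sub_zero, abs_le] at hx
      rcases le_total 0 x with h0 | h0
      · rw [potential_of_nonneg _ h0, potential_of_nonneg _ h0, ← sub_le_iff_le_add',
          ← Finset.sum_sub_distrib]
        refine Finset.sum_le_sum_of_subset_of_nonneg (Finset.Ico_subset_Ico_right hx.2)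
          fun y hy _ => ?_
        rw [Finset.mem_Ico] at hy
        exact sub_nonneg.2 (hle y (by omega))
      · rw [potential_of_nonpos _ h0, potential_of_nonpos _ h0]
        have : ∑ y ∈ Finset.Ico x 0, truncCrossTime K J (ξ e) y ≤
            ∑ y ∈ Finset.Ico x 0, Δ e y := Finset.sum_le_sum fun y hy => by
          rw [Finset.mem_Ico] at hy
          exact hle y (by omega)
        linarith
    have hgrid : ∀ x : ℤ, |x - 0| ≤ t → potential (Δ e) x ≤ c * x + (G + S) := fun x hx => by
      have h1 := hpot x hx
      rw [sub_zero] at hx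
      have h2 := abs_le.1 (abs_potential_truncCrossTime_le (α := α) hK J hM (ξ e) hx)
      linarith [h2.2]
    have hG : 0 ≤ G := (abs_nonneg _).trans
      (abs_potential_truncCrossTime_le (α := α) hK J hM (ξ e) (x := 0) (by simp))
    have hW := walkMean_mono (fun _ => ξ e) t hgrid
    rw [hexact, walkMean_add, walkMean_mul, walkMean_const] at hW
    set W := walkMean (fun _ => ξ e) t (fun x => (x : ℝ)) 0
    have h3 : c⁻¹ * t - W ≤ G + S := by
      have e1 : c⁻¹ * t - W = c⁻¹ * (t - c * W) := by field_simp
      rw [e1]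
      refine (mul_le_mul_of_nonneg_left (show t - c * W ≤ G + S by linarith)
        (by positivity)).trans ?_
      exact mul_le_of_le_one_left (by positivity) (inv_le_one_of_one_le₀ hc1)
    have h4 : staticSpeed α * t ≤ c⁻¹ * t := by gcongr
    linarith

/-- Apply e^u ≥ 1 + u to u = -log ρ: formally ⟨1/ρ⟩ ≥ 1 - ⟨log ρ⟩ ≥ 1. Positive and negative parts
stay on opposite sides, so ⟨log ρ⟩ = -∞ is allowed and only the finite positive part is cancelled.
-/
theorem one_le_meanRho_reflect {α : Measure (Set.Ioo (0 : ℝ) 1)} [IsProbabilityMeasure α]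
    (hα : MeanLogRhoNonpos α) : 1 ≤ meanRho (α.map reflectSite) := by
  obtain ⟨hfin, hle⟩ := hα
  have hlog : Measurable fun p => Real.log (rho p) := Real.measurable_log.comp measurable_rho
  rw [meanRho, lintegral_map measurable_rho.ennreal_ofReal measurable_reflectSite]
  have hpt : ∀ p, 1 + ENNReal.ofReal (-Real.log (rho p)) ≤
      ENNReal.ofReal (rho (reflectSite p)) + ENNReal.ofReal (Real.log (rho p)) := fun p => by
    have h1 : rho (reflectSite p) = Real.exp (-Real.log (rho p)) := by
      rw [Real.exp_neg, Real.exp_log (rho_pos p), rho, rho, inv_div]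
      simp [reflectSite]
    have h2 := Real.add_one_le_exp (-Real.log (rho p))
    rw [← h1] at h2
    have h3 := (rho_pos (reflectSite p)).le
    rw [← ENNReal.ofReal_one]
    rcases le_total 0 (Real.log (rho p)) with h | h
    · rw [ENNReal.ofReal_of_nonpos (neg_nonpos.2 h), add_zero, ← ENNReal.ofReal_add h3 h]
      exact ENNReal.ofReal_le_ofReal (by linarith)
    · rw [ENNReal.ofReal_of_nonpos h, add_zero, ← ENNReal.ofReal_add zero_le_one
        (neg_nonneg.2 h)]
      exact ENNReal.ofReal_le_ofReal (by linarith)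
  have hint := lintegral_mono (μ := α) hpt
  rw [lintegral_add_left measurable_const, lintegral_add_right _ hlog.ennreal_ofReal,
    lintegral_const, measure_univ, mul_one] at hint
  exact (ENNReal.add_le_add_iff_right hfin.ne).1 ((add_le_add_right hle 1).trans hint)

/-- The weak law of large numbers for the static walk, in mean. -/
theorem exists_static_bound {α : Measure (Set.Ioo (0 : ℝ) 1)} [IsProbabilityMeasure α]
    (hα : MeanLogRhoNonpos α) {ε : ℝ} (hε : 0 < ε) :
    ∃ A : ℝ, ∀ {E : Type} [MeasurableSpace E] (P : Measure E) [IsProbabilityMeasure P]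
      (ξ : E → SpaceEnv), IsIIDEnv α P ξ → ∀ t : ℕ,
      ∫ e, walkMean (fun _ => ξ e) t (fun x => |x - staticSpeed α * t|) 0 ∂P ≤ ε * t + A := by
  have h4 : 0 < ε / 4 := by positivity
  obtain ⟨A, hA⟩ := exists_static_upper α h4
  rcases lt_or_ge (meanRho α) 1 with h | h
  · obtain ⟨A', hA'⟩ := exists_static_lower α h h4
    refine ⟨2 * A + A', fun P _ ξ hξ t => ?_⟩
    obtain ⟨B, hB, hBi, hBw⟩ := hA P ξ hξ t
    obtain ⟨B', hB', hBi', hBw'⟩ := hA' P ξ hξ t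
    refine (integral_mono_of_nonneg (g := fun e => 2 * B e + B' e)
      (Eventually.of_forall fun e => walkMean_nonneg _ _ (fun _ => abs_nonneg _) _)
      ((hB.const_mul 2).add hB') (Eventually.of_forall fun e => ?_)).trans ?_
    -- From |z| = 2 z⁺ - z, the upper bound on the positive part and the lower bound on the mean
    -- suffice.
    · have habs : (fun x : ℤ => |(x : ℝ) - staticSpeed α * t|) = fun x : ℤ =>
          2 * max ((x : ℝ) - staticSpeed α * t) 0 + (-1 * (x : ℝ) + staticSpeed α * t) := by
        ext x
        rcases le_total ((x : ℝ) - staticSpeed α * t) 0 with h0 | h0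
        · rw [abs_of_nonpos h0, max_eq_right h0]
          ring
        · rw [abs_of_nonneg h0, max_eq_left h0]
          ring
      dsimp only
      rw [habs, walkMean_add, walkMean_mul, walkMean_add, walkMean_mul, walkMean_const]
      linarith [hBw e, hBw' e]
    · rw [integral_add (hB.const_mul 2) hB', integral_const_mul]
      have : 0 ≤ ε / 4 * t := by positivity
      linarith
  -- Here both the walk and its mirror image have speed 0, so the upper bound controls the positive
  -- and the negative part.
  · have : IsProbabilityMeasure (α.map reflectSite) :=
      Measure.isProbabilityMeasure_map measurable_reflectSite.aemeasurable
    have hv := staticSpeed_of_le h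
    have hv' := staticSpeed_of_le (one_le_meanRho_reflect hα)
    obtain ⟨A', hA'⟩ := exists_static_upper (α.map reflectSite) h4
    refine ⟨A + A', fun P _ ξ hξ t => ?_⟩
    obtain ⟨B, hB, hBi, hBw⟩ := hA P ξ hξ t
    obtain ⟨B', hB', hBi', hBw'⟩ := hA' P _ hξ.reflect t
    simp only [hv, hv', zero_mul, sub_zero] at hBw hBw' ⊢
    refine (integral_mono_of_nonneg (g := fun e => B e + B' e)
      (Eventually.of_forall fun e => walkMean_nonneg _ _ (fun _ => abs_nonneg _) _)
      (hB.add hB') (Eventually.of_forall fun e => ?_)).trans ?_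
    · have habs : (fun x : ℤ => |(x : ℝ)|) = fun x : ℤ =>
          max (x : ℝ) 0 + max ((-x : ℤ) : ℝ) 0 := by
        ext x
        push_cast
        rcases le_total (x : ℝ) 0 with h0 | h0
        · rw [abs_of_nonpos h0, max_eq_right h0, max_eq_left (neg_nonneg.2 h0), zero_add]
        · rw [abs_of_nonneg h0, max_eq_left h0, max_eq_right (neg_nonpos.2 h0), add_zero]
      dsimp only
      rw [habs, walkMean_add, walkMean_reflect _ t (fun x : ℤ => max (x : ℝ) 0), neg_zero]
      exact add_le_add (hBw e) (hBw' e)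
    · rw [integral_add hB hB']
      have : 0 ≤ ε / 4 * t := by positivity
      linarith

/-! ### The cooling environment -/

section

variable {τ : ℕ → ℕ}

theorem lastResampling_eq (hτ : StrictMono τ) {k n : ℕ} (h1 : τ k ≤ n) (h2 : n < τ (k + 1)) :
    lastResampling τ n = k := by
  rw [lastResampling, Nat.findGreatest_eq_iff]
  refine ⟨(hτ.id_le k).trans h1, fun _ => h1, fun m hm _ h => ?_⟩
  exact absurd ((hτ.monotone (Nat.succ_le_of_lt hm)).trans h) h2.not_ge

theorem lastResampling_spec (hτ0 : τ 0 = 0) (n : ℕ) : τ (lastResampling τ n) ≤ n :=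
  Nat.findGreatest_spec (P := fun k => τ k ≤ n) (Nat.zero_le n) (by simp [hτ0])

theorem lt_lastResampling_succ (hτ : StrictMono τ) (n : ℕ) : n < τ (lastResampling τ n + 1) := by
  by_contra! h
  exact absurd (Nat.le_findGreatest (P := fun k => τ k ≤ n) ((hτ.id_le _).trans h) h)
    (Nat.lt_succ_self _).not_ge

/-- Beyond some index each block is longer than 1/δ, so δ τ(k) then grows by at least one with k;
`k₀` pays for the short blocks. -/
theorem exists_index_le (hT : Tendsto (fun k => τ (k + 1) - τ k) atTop atTop)
    (hτ : StrictMono τ) {δ : ℝ} (hδ : 0 < δ) : ∃ k₀ : ℕ, ∀ k : ℕ, (k : ℝ) ≤ δ * τ k + k₀ := by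
  obtain ⟨N, hN⟩ := exists_nat_ge δ⁻¹
  obtain ⟨k₀, hk₀⟩ := eventually_atTop.1 (hT.eventually_ge_atTop N)
  refine ⟨k₀, fun k => ?_⟩
  induction k with
  | zero => simp; positivity
  | succ k ih =>
    rcases le_or_gt (k + 1) k₀ with h | h
    · have : ((k + 1 : ℕ) : ℝ) ≤ k₀ := by exact_mod_cast h
      have : 0 ≤ δ * τ (k + 1) := by positivity
      linarith
    · have h1 : N + τ k ≤ τ (k + 1) := by
        have := hk₀ k (by omega)
        have := hτ k.lt_add_one
        omega
      have h2 : (N : ℝ) + τ k ≤ τ (k + 1) := by exact_mod_cast h1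
      have h3 : 1 ≤ δ * N := by
        rw [mul_comm]
        exact (inv_le_iff_one_le_mul₀ hδ).1 hN
      have h4 := mul_le_mul_of_nonneg_left h2 hδ.le
      push_cast
      linarith

end

section

variable (α : Measure (Set.Ioo (0 : ℝ) 1)) [IsProbabilityMeasure α]

theorem isIIDEnv_eval (k : ℕ) :
    IsIIDEnv α (Measure.infinitePi fun _ : ℕ => spaceEnvLaw α) fun η => η k := by
  have hm : ∀ x : ℤ, Measurable fun η : ℕ → SpaceEnv => η k x := fun x => by fun_prop
  have hk : (Measure.infinitePi fun _ : ℕ => spaceEnvLaw α).map (fun η => η k) =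
      Measure.infinitePi fun _ : ℤ => α := Measure.infinitePi_map_eval _ k
  have hlaw : ∀ x : ℤ, (Measure.infinitePi fun _ : ℕ => spaceEnvLaw α).map (fun η => η k x) = α :=
    fun x => by
      have h := Measure.infinitePi_map_eval (fun _ : ℤ => α) x
      rw [← hk, Measure.map_map (by fun_prop) (by fun_prop)] at h
      exact h
  refine ⟨?_, hm, hlaw⟩
  rw [iIndepFun_iff_map_fun_eq_infinitePi_map hm]
  simp only [hlaw]
  exact hk

variable {α}

/-- The environment at time `s ≤ τ k` is independent of `η_k`. -/
theorem indepFun_walkMean {τ : ℕ → ℕ} (hτ0 : τ 0 = 0) (hτ : StrictMono τ) (k : ℕ) (f : ℤ → ℝ)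
    {h : SpaceEnv → ℝ} (hh : Measurable h) :
    IndepFun (fun η : ℕ → SpaceEnv => walkMean (fun i => η (lastResampling τ i)) (τ k) f 0)
      (fun η => h (η k)) (Measure.infinitePi fun _ : ℕ => spaceEnvLaw α) := by
  have hi : iIndepFun (fun (i : ℕ) (η : ℕ → SpaceEnv) => η i)
      (Measure.infinitePi fun _ : ℕ => spaceEnvLaw α) :=
    iIndepFun_infinitePi (X := fun _ ω => ω) fun _ => measurable_id
  have hfin := hi.indepFun_finset (Finset.range k) {k} (by simp) fun i => by fun_prop
  -- A filler for indices at least k; before time τ(k) only earlier samples are in force.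
  let half : SpaceEnv := fun _ => ⟨1 / 2, by norm_num, by norm_num⟩
  let ext (u : Finset.range k → SpaceEnv) (i : ℕ) : SpaceEnv :=
    if hi : i ∈ Finset.range k then u ⟨i, hi⟩ else half
  have hext : ∀ i, Measurable fun u => ext u i := fun i => by
    by_cases h : i ∈ Finset.range k
    · simp only [ext, h, dif_pos]
      exact measurable_pi_apply _
    · simp only [ext, h, dif_neg, not_false_eq_true]
      exact measurable_const
  have hφ : Measurable fun u => walkMean (fun i => ext u (lastResampling τ i)) (τ k) f 0 :=
    measurable_walkMean_const (Ω := fun u i => ext u (lastResampling τ i))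
      (measurable_pi_lambda _ fun i => hext _) _ f 0
  have hψ : Measurable fun u : ({k} : Finset ℕ) → SpaceEnv => h (u ⟨k, by simp⟩) :=
    hh.comp (measurable_pi_apply _)
  have := hfin.comp hφ hψ
  convert this using 1
  · ext η
    simp only [Function.comp]
    rw [walkMean_env_congr fun i hi => ?_]
    have : lastResampling τ i ∈ Finset.range k :=
      Finset.mem_range.2 (hτ.lt_iff_lt.1 ((lastResampling_spec hτ0 i).trans_lt hi))
    simp only [ext, this, dif_pos]
  · rfl

theorem walkMean_abs_sub_le (Ω : SpaceTimeEnv) (n : ℕ) (v c : ℝ) :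
    walkMean Ω n (fun x => |x - v * c|) 0 ≤ n + |v * c| := by
  have h := walkMean_mono Ω n (f := fun x => |(x : ℝ) - v * c|) (g := fun _ => n + |v * c|) (x := 0)
    fun y hy => by
      rw [sub_zero] at hy
      refine (abs_sub _ _).trans (add_le_add_left ?_ _)
      exact_mod_cast hy
  rwa [walkMean_const] at h

theorem integrable_walkMean_abs {E : Type*} [MeasurableSpace E] {P : Measure E}
    [IsFiniteMeasure P] {Ω : E → SpaceTimeEnv} (hΩ : Measurable Ω) (n : ℕ) (v c : ℝ) :
    Integrable (fun e => walkMean (Ω e) n (fun x => |x - v * c|) 0) P := by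
  refine Integrable.of_bound (measurable_walkMean_const hΩ n _ 0).aestronglyMeasurable (n + |v * c|) (Eventually.of_forall fun e => ?_)
  rw [Real.norm_eq_abs, abs_of_nonneg (walkMean_nonneg _ _ (fun _ => abs_nonneg _) _)]
  exact walkMean_abs_sub_le _ _ _ _

/-- Mean deviation at time `n` of the walk from the point `v n`. -/
noncomputable def meanDeviation (α : Measure (Set.Ioo (0 : ℝ) 1)) [IsProbabilityMeasure α]
    (τ : ℕ → ℕ) (v : ℝ) (n : ℕ) : ℝ :=
  ∫ η, walkMean (fun i => η (lastResampling τ i)) n (fun x => |x - v * n|) 0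
    ∂Measure.infinitePi fun _ : ℕ => spaceEnvLaw α

/-- Split the deviation at the resampling time by the triangle inequality. The expected displacement
error of the block is a sum over positions z of P(X = z) times the error started at z; independence
factors each term, translation invariance bounds the second factor by b, and the probabilities sum
to one. -/
theorem meanDeviation_add_le {τ : ℕ → ℕ} (hτ0 : τ 0 = 0) (hτ : StrictMono τ) {v b : ℝ}
    {k t : ℕ} (ht : τ k + t ≤ τ (k + 1))
    (hb : ∀ {E : Type} [MeasurableSpace E] (P : Measure E) [IsProbabilityMeasure P]
      (ξ : E → SpaceEnv), IsIIDEnv α P ξ →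
      ∫ e, walkMean (fun _ => ξ e) t (fun x => |x - v * t|) 0 ∂P ≤ b) :
    meanDeviation α τ v (τ k + t) ≤ meanDeviation α τ v (τ k) + b := by
  unfold meanDeviation
  set Q := Measure.infinitePi fun _ : ℕ => spaceEnvLaw α
  let Ω : (ℕ → SpaceEnv) → SpaceTimeEnv := fun η i => η (lastResampling τ i)
  have hΩ : Measurable Ω := measurable_cooling τ
  -- The block started at y, moved to the origin by shifting the environment.
  let h : SpaceEnv → ℤ → ℝ := fun ω y =>
    walkMean (fun _ z => ω (z + y)) t (fun x => |x - v * t|) 0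
  have hh : ∀ y, Measurable fun ω => h ω y := fun y =>
    measurable_walkMean_const (Ω := fun (ω : SpaceEnv) _ z => ω (z + y)) (by fun_prop) t _ 0
  have hhk : ∀ y, Measurable fun η : ℕ → SpaceEnv => h (η k) y := fun y =>
    (hh y).comp (measurable_pi_apply k)
  have hhi : ∀ y, Integrable (fun η : ℕ → SpaceEnv => h (η k) y) Q := fun y =>
    integrable_walkMean_abs (Ω := fun (η : ℕ → SpaceEnv) _ z => η k (z + y)) (by fun_prop) t v t
  let p : (ℕ → SpaceEnv) → ℤ → ℝ := fun η z =>
    walkMean (Ω η) (τ k) (fun y => if y = z then 1 else 0) 0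
  have hp : ∀ z, Measurable fun η => p η z := fun z =>
    measurable_walkMean_const hΩ _ _ 0
  have hp0 : ∀ η z, 0 ≤ p η z := fun η z =>
    walkMean_nonneg _ _ (fun y => by split_ifs <;> norm_num) _
  have hpsum : ∀ η, ∑ z ∈ Finset.Icc (-(τ k) : ℤ) (τ k), p η z = 1 := fun η => by
    have := walkMean_eq_sum (Ω η) (τ k) (fun _ => 1)
    simp only [walkMean_const, mul_one] at this
    exact this.symm
  have hpi : ∀ z, Integrable (fun η => p η z) Q := fun z => by
    refine Integrable.of_bound (hp z).aestronglyMeasurable 1 (Eventually.of_forall fun η => ?_)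
    rw [Real.norm_eq_abs, abs_of_nonneg (hp0 η z)]
    have h1 : p η z ≤ walkMean (Ω η) (τ k) (fun _ => 1) 0 :=
      walkMean_mono _ _ fun y _ => by split_ifs <;> norm_num
    rwa [walkMean_const] at h1
  have hpt : ∀ η, walkMean (Ω η) (τ k + t) (fun x => |x - v * (τ k + t : ℕ)|) 0 ≤
      walkMean (Ω η) (τ k) (fun x => |x - v * τ k|) 0 +
        ∑ z ∈ Finset.Icc (-(τ k) : ℤ) (τ k), p η z * h (η k) z := fun η => by
    rw [walkMean_time_add, ← walkMean_eq_sum (Ω η) (τ k) (h (η k)), ← walkMean_add]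
    refine walkMean_mono _ _ fun y _ => ?_
    have henv : ∀ i < t, (fun i => Ω η (τ k + i)) i = (fun _ => η k) i := fun i hi => by
      simp only [Ω]
      rw [lastResampling_eq hτ (Nat.le_add_right _ _) (by omega)]
    have htr := walkMean_translate (fun _ => η k) t (fun z => |(z : ℝ) - y - v * t|) 0 y
    rw [zero_add] at htr
    have hcong : h (η k) y = walkMean (fun _ => η k) t (fun z => |(z : ℝ) - y - v * t|) y := by
      rw [htr]
      simp [h]
    rw [walkMean_env_congr henv, hcong]
    have hc := congrFun (walkMean_const (fun _ => η k) t |(y : ℝ) - v * τ k|) y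
    rw [← hc, ← walkMean_add]
    refine walkMean_mono _ _ fun z _ => ?_
    rw [show (z : ℝ) - v * (τ k + t : ℕ) = (y - v * τ k) + (z - y - v * t) by push_cast; ring]
    exact abs_add_le _ _
  have hprod : ∀ z, Integrable (fun η => p η z * h (η k) z) Q ∧
      ∫ η, p η z * h (η k) z ∂Q ≤ (∫ η, p η z ∂Q) * b := fun z => by
    have hind : IndepFun (fun η => p η z) (fun η => h (η k) z) Q :=
      indepFun_walkMean hτ0 hτ k _ (hh z)
    refine ⟨hind.integrable_mul (hpi z) (hhi z), ?_⟩
    rw [hind.integral_fun_mul_eq_mul_integral (hp z).aestronglyMeasurable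
      (hhk z).aestronglyMeasurable]
    exact mul_le_mul_of_nonneg_left (hb Q _ ((isIIDEnv_eval α k).translate z))
      (integral_nonneg fun η => hp0 η z)
  have hf := integrable_walkMean_abs (P := Q) hΩ (τ k) v (τ k)
  have hs : Integrable (fun η => ∑ z ∈ Finset.Icc (-(τ k) : ℤ) (τ k), p η z * h (η k) z) Q :=
    integrable_finsetSum _ fun z _ => (hprod z).1
  refine (integral_mono (integrable_walkMean_abs hΩ _ v _) (hf.add hs) hpt).trans ?_
  simp only [Pi.add_apply]
  rw [integral_add hf hs, integral_finsetSum _ fun z _ => (hprod z).1]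
  gcongr
  refine (Finset.sum_le_sum fun z _ => (hprod z).2).trans ?_
  rw [← Finset.sum_mul, ← integral_finsetSum _ fun z _ => hpi z]
  simp [hpsum]

theorem exists_meanDeviation_le (hα : MeanLogRhoNonpos α) {τ : ℕ → ℕ} (hτ0 : τ 0 = 0)
    (hτ : StrictMono τ) (hT : Tendsto (fun k => τ (k + 1) - τ k) atTop atTop) {ε : ℝ}
    (hε : 0 < ε) : ∃ A : ℝ, ∀ n, meanDeviation α τ (staticSpeed α) n ≤ ε * n + A := by
  obtain ⟨A₀, hA₀⟩ := exists_static_bound hα (half_pos hε)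
  set A := max A₀ 0
  have hA0 : 0 ≤ A := le_max_right _ _
  have hblock : ∀ k t, τ k + t ≤ τ (k + 1) → meanDeviation α τ (staticSpeed α) (τ k + t) ≤
      meanDeviation α τ (staticSpeed α) (τ k) + (ε / 2 * t + A) := fun k t ht =>
    meanDeviation_add_le hτ0 hτ ht fun P _ ξ hξ =>
      (hA₀ P ξ hξ t).trans (add_le_add_right (le_max_left _ _) _)
  have hτk : ∀ k, meanDeviation α τ (staticSpeed α) (τ k) ≤ ε / 2 * τ k + A * k := fun k => by
    induction k with
    | zero => simp [hτ0, meanDeviation]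
    | succ k ih =>
      obtain ⟨t, ht⟩ := Nat.exists_eq_add_of_le (hτ (Nat.lt_succ_self k)).le
      have := hblock k t ht.ge
      rw [← Nat.succ_eq_add_one, ht]
      push_cast
      linarith
  -- With this δ, the accumulated constants A k are at most (ε/2) τ(k) plus a constant; `A + 1`
  -- avoids dividing by zero.
  obtain ⟨k₀, hk₀⟩ := exists_index_le hT hτ (δ := ε / 2 / (A + 1)) (by positivity)
  refine ⟨A * (k₀ + 1), fun n => ?_⟩
  set k := lastResampling τ n
  obtain ⟨t, ht⟩ := Nat.exists_eq_add_of_le (lastResampling_spec hτ0 n)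
  have h1 := hblock k t (ht ▸ (lt_lastResampling_succ hτ n).le)
  have h2 : A * k ≤ ε / 2 * τ k + A * k₀ := by
    have h3 := mul_le_mul_of_nonneg_left (hk₀ k) hA0
    have h4 : A * (ε / 2 / (A + 1)) ≤ ε / 2 := by
      rw [mul_div_assoc', div_le_iff₀ (by positivity)]
      nlinarith
    have h5 := mul_le_mul_of_nonneg_right h4 (Nat.cast_nonneg (τ k) : (0 : ℝ) ≤ τ k)
    linarith
  have h6 : (n : ℝ) = τ k + t := by exact_mod_cast ht
  have h7 : 0 ≤ ε / 2 * t := by positivity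
  rw [← ht] at h1
  rw [h6]
  linarith [hτk k]

/-! ### From mean deviation to convergence in probability -/

theorem tendsto_meanDeviation_div (hα : MeanLogRhoNonpos α) {τ : ℕ → ℕ} (hτ0 : τ 0 = 0)
    (hτ : StrictMono τ) (hT : Tendsto (fun k => τ (k + 1) - τ k) atTop atTop) :
    Tendsto (fun n : ℕ => (n : ℝ)⁻¹ * meanDeviation α τ (staticSpeed α) n) atTop (nhds 0) := by
  have h0 : ∀ n, 0 ≤ meanDeviation α τ (staticSpeed α) n := fun n =>
    integral_nonneg fun η => walkMean_nonneg _ _ (fun _ => abs_nonneg _) _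
  rw [Metric.tendsto_atTop]
  intro ε hε
  obtain ⟨A, hA⟩ := exists_meanDeviation_le hα hτ0 hτ hT (half_pos hε)
  obtain ⟨N, hN⟩ := exists_nat_gt (max (A / (ε / 2)) 0)
  refine ⟨N, fun n hn => ?_⟩
  have hnN : (N : ℝ) ≤ n := by exact_mod_cast hn
  have hn0 : (0 : ℝ) < n := ((le_max_right _ _).trans_lt hN).trans_le hnN
  have hAn : A < ε / 2 * n := by
    have := ((le_max_left _ _).trans_lt hN).trans_le hnN
    rw [div_lt_iff₀ (half_pos hε)] at this
    linarith
  rw [Real.dist_eq, sub_zero, abs_of_nonneg (mul_nonneg (by positivity) (h0 n)),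
    inv_mul_lt_iff₀ hn0]
  linarith [hA n]

theorem lintegral_annealedLaw_abs (τ : ℕ → ℕ) (v : ℝ) {n : ℕ} (hn : 0 < n) :
    ∫⁻ x, edist ((x n : ℝ) / n) v ∂annealedLaw α τ =
      ENNReal.ofReal ((n : ℝ)⁻¹ * meanDeviation α τ v n) := by
  have hn' : (0 : ℝ) < n := by exact_mod_cast hn
  have habs : ∀ y : ℤ, |(y : ℝ) / n - v| = (n : ℝ)⁻¹ * |y - v * n| := fun y => by
    rw [show (y : ℝ) / n - v = (n : ℝ)⁻¹ * (y - v * n) by field_simp, abs_mul,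
      abs_of_pos (inv_pos.2 hn')]
  simp only [edist_dist, Real.dist_eq]
  rw [lintegral_annealedLaw α τ n (f := fun y => |(y : ℝ) / n - v|) fun _ => abs_nonneg _,
    ← ofReal_integral_eq_lintegral_ofReal]
  · simp only [habs, walkMean_mul]
    rw [integral_const_mul]
    rfl
  · simp only [habs, walkMean_mul]
    exact (integrable_walkMean_abs (measurable_cooling τ) n v n).const_mul _
  · exact Eventually.of_forall fun η => walkMean_nonneg _ _ (fun _ => abs_nonneg _) _

theorem measurable_walk_div (n : ℕ) : Measurable fun x : ℕ → ℤ => (x n : ℝ) / n :=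
  (measurable_of_countable fun y : ℤ => (y : ℝ) / n).comp (measurable_pi_apply n)

theorem tendstoInMeasure_walk (hα : MeanLogRhoNonpos α) {τ : ℕ → ℕ} (hτ0 : τ 0 = 0)
    (hτ : StrictMono τ) (hT : Tendsto (fun k => τ (k + 1) - τ k) atTop atTop) :
    TendstoInMeasure (annealedLaw α τ) (fun (n : ℕ) (x : ℕ → ℤ) => (x n : ℝ) / n) atTop
      (fun _ => staticSpeed α) := by
  refine tendstoInMeasure_of_ne_top fun ε hε hε' => ?_
  have hlim : Tendsto (fun n : ℕ => ENNReal.ofReal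
      ((n : ℝ)⁻¹ * meanDeviation α τ (staticSpeed α) n) / ε) atTop (nhds 0) := by
    have := ENNReal.Tendsto.div_const
      (ENNReal.tendsto_ofReal (tendsto_meanDeviation_div hα hτ0 hτ hT)) (Or.inr hε.ne')
    simpa using this
  refine tendsto_of_tendsto_of_tendsto_of_le_of_le' tendsto_const_nhds hlim
    (Eventually.of_forall fun n => zero_le) ?_
  filter_upwards [eventually_gt_atTop 0] with n hn
  rw [← lintegral_annealedLaw_abs τ _ hn]
  exact meas_ge_le_lintegral_div
    ((measurable_walk_div n).edist measurable_const).aemeasurable hε.ne' hε'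

end

end RWCRE

theorem mainTheorem2 (α : Measure (Set.Ioo (0 : ℝ) 1)) [IsProbabilityMeasure α]
    (hα : RWCRE.MeanLogRhoNonpos α)
    (τ : ℕ → ℕ) (hτ0 : τ 0 = 0) (hτ : StrictMono τ)
    (hT : Tendsto (fun k => τ (k + 1) - τ k) atTop atTop) :
    TendstoInDistribution (fun (n : ℕ) (x : ℕ → ℤ) => (x n : ℝ) / n) atTop
        (fun _ : ℕ → ℤ => RWCRE.staticSpeed α)
        (fun _ => RWCRE.annealedLaw α τ) (RWCRE.annealedLaw α τ) ∧
      TendstoInMeasure (RWCRE.annealedLaw α τ)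
        (fun (n : ℕ) (x : ℕ → ℤ) => (x n : ℝ) / n) atTop
        (fun _ => RWCRE.staticSpeed α) := by
  have h := RWCRE.tendstoInMeasure_walk hα hτ0 hτ hT
  exact ⟨h.tendstoInDistribution fun n => (RWCRE.measurable_walk_div n).aemeasurable, h⟩
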